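/- Let $A$ be a finite-dimensional semisimple $\mathbb{Q}$-algebra and let $\mathfrak{A}\subseteq A$ be an order, i.e. a (unital) subring that is finitely generated as a $\mathbb{Z}$-module and satisfies $\mathbb{Q}\cdot\mathfrak{A}=A$. Suppose that $\mathfrak{A}$ is hereditary, i.e. all its left ideals and all its right ideals are projective $\mathfrak{A}$-modules. A locally compact right $\mathfrak{A}$-module is a right $\mathfrak{A}$-module $M$ whose additive group is equipped with the structure of a locally compact Hausdorff topological abelian group such that right multiplication by each $\alpha\in\mathfrak{A}$ is continuous; morphisms are the continuous $\mathfrak{A}$-module homomorphisms. Then for every locally compact right $\mathfrak{A}$-module $M$: 1. If $M$ has no small subgroups (some neighbourhood of $0$ contains no non-trivial subgroup of $M$), then there is an isomorphism of topological right $\mathfrak{A}$-modules $M\cong V\oplus T\oplus D$, where $V$ is a vector module (its underlying topological group is isomorphic to $\mathbb{R}^n$ for some $n\ge 0$), $T$ is a finite-dimensional real torus (its underlying topological group is isomorphic to $(\mathbb{R}/\mathbb{Z})^m$ for some $m\ge 0$), and $D$ is discrete. 2. If $M$ is compactly generated (there is a symmetric compact subset $C_0\subseteq M$ such that every element of $M$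 is a finite sum of elements of $C_0$), then there is an isomorphism of topological right $\mathfrak{A}$-modules $M\cong V\oplus G\oplus C$, where $V$ is a vector module, $G$ is a discrete module that is free of finite rank as a $\mathbb{Z}$-module, and $C$ is compact. The analogous claims hold for left $\mathfrak{A}$-modules. -/

import Mathlib

open Topology

namespace LCAModule

/-- A subring `𝔄` of a `ℚ`-algebra `A` is a (`ℤ`-)order if it is finitely generated as a
`ℤ`-module and `ℚ · 𝔄 = A`. -/
structure IsZOrder {A : Type*} [Ring A] [Algebra ℚ A] (𝔄 : Subring A) : Prop where
  finite : Module.Finite ℤ 𝔄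
  span_eq_top : Submodule.span ℚ (𝔄 : Set A) = ⊤

/-- A ring is hereditary if all its left ideals and all its right ideals are projective.
Right `R`-modules are modules over `Rᵐᵒᵖ`, so right ideals are `Rᵐᵒᵖ`-submodules of `R`. -/
structure IsHereditaryRing (R : Type*) [Ring R] : Prop where
  left : ∀ I : Submodule R R, Module.Projective R I
  right : ∀ I : Submodule Rᵐᵒᵖ R, Module.Projective Rᵐᵒᵖ I

section Groups

variable (G : Type*) [AddCommGroup G] [TopologicalSpace G]

/-- Some neighbourhood of `0` contains no non-trivial subgroup. -/
def NoSmallSubgroups : Prop :=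
  ∃ U ∈ 𝓝 (0 : G), ∀ H : AddSubgroup G, (H : Set G) ⊆ U → H = ⊥

/-- There is a symmetric compact subset `C` such that every element of `G` is a finite sum
of elements of `C`. -/
def CompactlyGeneratedGroup : Prop :=
  ∃ C : Set G, IsCompact C ∧ (∀ c ∈ C, -c ∈ C) ∧
    ∀ g : G, ∃ (n : ℕ) (c : Fin n → G), (∀ i, c i ∈ C) ∧ g = ∑ i, c i

/-- `G` is isomorphic to `ℝⁿ` as a topological group, for some `n ≥ 0`. -/
def IsVectorGroup : Prop :=
  ∃ n : ℕ, Nonempty (G ≃ₜ+ (Fin n → ℝ))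

/-- `G` is isomorphic to `𝕋ⁿ = (ℝ/ℤ)ⁿ` as a topological group, for some `n ≥ 0`. -/
def IsFiniteDimTorus : Prop :=
  ∃ n : ℕ, Nonempty (G ≃ₜ+ (Fin n → UnitAddCircle))

end Groups

section Splittings

variable (R M : Type*) [Ring R] [AddCommGroup M] [Module R M] [TopologicalSpace M]

variable {R M} in
/-- `M = X ⊕ Y ⊕ Z` as topological `R`-modules: the addition map from `X × Y × Z` to `M` is an
`R`-linear homeomorphism. -/
def IsTopDirectSum (X Y Z : Submodule R M) : Prop :=
  ∃ e : (X × Y × Z) ≃L[R] M, ∀ p : X × Y × Z, e p = (p.1 : M) + (p.2.1 : M) + (p.2.2 : M)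

/-- `M ≅ V ⊕ T ⊕ D` as topological `R`-modules, with `V` a vector module, `T` a
finite-dimensional real torus and `D` discrete. -/
def SplitsVectorTorusDiscrete : Prop :=
  ∃ V T D : Submodule R M,
    IsVectorGroup V ∧ IsFiniteDimTorus T ∧ DiscreteTopology D ∧ IsTopDirectSum V T D

/-- `M ≅ V ⊕ G ⊕ C` as topological `R`-modules, with `V` a vector module, `G` a (discrete) free
`ℤ`-module of finite rank and `C` compact. -/
def SplitsVectorLatticeCompact : Prop :=
  ∃ V G C : Submodule R M,
    IsVectorGroup V ∧ (Module.Free ℤ G ∧ Module.Finite ℤ G ∧ DiscreteTopology G) ∧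
      CompactSpace C ∧ IsTopDirectSum V G C

end Splittings

end LCAModule

set_option linter.unusedSectionVars false

namespace LCAModule

open MeasureTheory Filter
open scoped Pointwise

/-! The proof has a topological half, which finds the pieces inside the underlying locally compact
abelian group, and an algebraic half, which makes the splittings linear over the order.

Topology. Characters of the regular representation on L² separate points
(`exists_continuous_addChar_ne_one`). By compactness, finitely many of them cut out, near 0, an
arbitrarily small compact subgroup; modulo it, their arguments embed a neighbourhood of 0 in a real
vector space as a closed local subgroup. Such a local subgroup is linear near 0, so
`exists_exponential` gives an open, locally injective homomorphism E from ℝⁿ. Its discrete kernel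
spans a torus containing all compact elements of the image (`exists_maximal_torus`). Without small
subgroups, E already exists on M. In a compactly generated M the compact elements form a compact
subgroup K, and on M/K the map E is injective.

Algebra. The regular trace form of the semisimple algebra yields a Casimir element, a family a i, b
i in the order with ∑ a i * b i = N ≠ 0. Averaging over it turns additive maps into linear ones, so
a proper surjection onto a vector module splits as soon as it splits for groups. Heredity enters
twice: lattices are projective (`IsHereditaryOrder.projective_of_lattice`), and divisible modules
are injective (`IsHereditaryOrder.baer_of_divisible`). Injectivity splits off the open divisible
image of E, leaving a discrete complement; projectivity splits off the lattice quotient (M/K)/E(ℝⁿ).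
Sections over vector modules then separate the vector part from the torus or from the compact part.
-/

open scoped IsMulCommutative in
/-- A family of elements of a C⋆-algebra that commute with each other and with each other's
adjoints lies in a star subalgebra on which the contractive characters separate points. -/
theorem exists_starSubalgebra_characters_separating {A : Type*} [CStarAlgebra A] (s : Set A)
    (hcomm : ∀ a ∈ s, ∀ b ∈ s, a * b = b * a)
    (hstar : ∀ a ∈ s, ∀ b ∈ s, a * star b = star b * a) :
    ∃ S : StarSubalgebra ℂ A, s ⊆ S ∧
      ∀ a : S, a ≠ 0 → ∃ φ : S →⋆ₐ[ℂ] ℂ, φ a ≠ 0 ∧ ∀ x, ‖φ x‖ ≤ ‖x‖ := by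
  have := StarAlgebra.isMulCommutative_adjoin ℂ hcomm hstar
  -- Taking the closure makes `S` a commutative C⋆-algebra, whose Gelfand transform is isometric and
  -- hence detects every non-zero element.
  let S := (StarAlgebra.adjoin ℂ s).topologicalClosure
  have hS : IsClosed (S : Set A) := StarSubalgebra.isClosed_topologicalClosure _
  refine ⟨S, (StarAlgebra.subset_adjoin ℂ s).trans (StarSubalgebra.le_topologicalClosure _), ?_⟩
  let _ : CommCStarAlgebra S :=
    { StarSubalgebra.cstarAlgebra S with
      mul_comm := (StarSubalgebra.commRingTopologicalClosure (StarAlgebra.adjoin ℂ s)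
        (fun x y => mul_comm x y)).mul_comm }
  intro a ha
  have h1 : WeakDual.gelfandTransform ℂ S a ≠ 0 := by
    rw [Ne, map_eq_zero_iff _ (gelfandTransform_isometry S).injective]
    exact ha
  obtain ⟨φ, hφ⟩ : ∃ φ, WeakDual.gelfandTransform ℂ S a φ ≠ 0 := by
    by_contra! h
    exact h1 (ContinuousMap.ext h)
  refine ⟨(StarAlgHomClass.toStarAlgHom φ : S →⋆ₐ[ℂ] ℂ), hφ, fun x => ?_⟩
  exact NonUnitalStarAlgHom.norm_apply_le (φ : S →⋆ₐ[ℂ] ℂ) x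

/-! ### Continuous characters from unitary representations -/

section Convolution

variable {G : Type*} [AddCommGroup G] [TopologicalSpace G] [IsTopologicalAddGroup G] [T2Space G]
  [LocallyCompactSpace G] [MeasurableSpace G] [BorelSpace G]
  {H : Type*} [NormedAddCommGroup H] [InnerProductSpace ℂ H] [CompleteSpace H]

theorem integrable_smul_of_compactSupport {f : G → ℂ} (hf : Continuous f)
    (hfs : HasCompactSupport f) (μ : Measure G) [IsFiniteMeasureOnCompacts μ]
    {u : G → H} (hu : Continuous u) : Integrable (fun x => f x • u x) μ :=
  (hf.smul hu).integrable_of_hasCompactSupport hfs.smul_right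

/-- The operator `h ↦ ∫ f(x) τ(x) h dx` attached to a compactly supported function `f` and a
strongly continuous isometric representation `τ`. -/
noncomputable def convOperator (τ : G → H →L[ℂ] H) (hτ : ∀ h, Continuous fun x => τ x h)
    (hn : ∀ x h, ‖τ x h‖ = ‖h‖) (μ : Measure G) [IsFiniteMeasureOnCompacts μ] (f : G → ℂ)
    (hf : Continuous f) (hfs : HasCompactSupport f) : H →L[ℂ] H :=
  LinearMap.mkContinuous
    { toFun := fun h => ∫ x, f x • τ x h ∂μ
      map_add' := fun h k => by
        simp only [map_add, smul_add]
        exact integral_add (integrable_smul_of_compactSupport hf hfs μ (hτ h))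
          (integrable_smul_of_compactSupport hf hfs μ (hτ k))
      map_smul' := fun c h => by
        simp only [map_smul, RingHom.id_apply]
        rw [← integral_smul]
        congr 1 with x
        rw [smul_comm] }
    (∫ x, ‖f x‖ ∂μ) (fun h => by
      refine (norm_integral_le_integral_norm _).trans ?_
      simp only [norm_smul, hn]
      rw [integral_mul_const])

theorem convOperator_apply (τ : G → H →L[ℂ] H) (hτ : ∀ h, Continuous fun x => τ x h)
    (hn : ∀ x h, ‖τ x h‖ = ‖h‖) (μ : Measure G) [IsFiniteMeasureOnCompacts μ] (f : G → ℂ)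
    (hf : Continuous f) (hfs : HasCompactSupport f) (h : H) :
    convOperator τ hτ hn μ f hf hfs h = ∫ x, f x • τ x h ∂μ := rfl

/-- `B` passes under the integral. Used with `B = τ x`, and with the adjoint of the operator itself
to see that the operator is normal. -/
theorem commute_convOperator (τ : G → H →L[ℂ] H) (hτ : ∀ h, Continuous fun x => τ x h)
    (hn : ∀ x h, ‖τ x h‖ = ‖h‖) (μ : Measure G) [IsFiniteMeasureOnCompacts μ] (f : G → ℂ)
    (hf : Continuous f) (hfs : HasCompactSupport f) (B : H →L[ℂ] H)
    (hB : ∀ x, B * τ x = τ x * B) :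
    B * convOperator τ hτ hn μ f hf hfs = convOperator τ hτ hn μ f hf hfs * B := by
  ext h
  simp only [mul_apply_eq_comp, convOperator_apply]
  rw [← ContinuousLinearMap.integral_comp_comm _
    (integrable_smul_of_compactSupport hf hfs μ (hτ h))]
  congr 1 with x
  have := congrArg (fun C : H →L[ℂ] H => C h) (hB x)
  simp only [mul_apply_eq_comp] at this
  rw [map_smul, this]

/-- A compactly supported continuous function is continuous under translation in `L¹`. -/
theorem tendsto_integral_norm_translate_sub (μ : Measure G) [μ.IsAddHaarMeasure] [μ.Regular]
    {f : G → ℂ} (hf : Continuous f) (hfs : HasCompactSupport f) :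
    Tendsto (fun y => ∫ x, ‖f (x - y) - f x‖ ∂μ) (𝓝 0) (𝓝 0) := by
  obtain ⟨K, hK, hK0⟩ := exists_compact_mem_nhds (0 : G)
  -- This compact set contains the supports of `f` and of all its translates by `y ∈ K`, so uniform
  -- smallness on it controls the integral.
  have hcK : IsCompact (tsupport f + K) := hfs.isCompact.add hK
  rw [Metric.tendsto_nhds]
  intro ε hε
  set c := μ.real (tsupport f + K) with hc
  have hc0 : 0 ≤ c := measureReal_nonneg
  have hunif : ∀ᶠ y in 𝓝 (0 : G), ∀ x ∈ tsupport f + K,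
      ‖f (x - y) - f x‖ < ε / (2 * (c + 1)) := by
    refine hcK.eventually_forall_of_forall_eventually fun x _ => ?_
    have hcont : Continuous fun z : G × G => ‖f (z.2 - z.1) - f z.2‖ := by fun_prop
    have hlt : ‖f ((0, x) : G × G).2 - f x‖ < ε / (2 * (c + 1)) := by
      simp only [sub_self, norm_zero]; positivity
    refine hcont.continuousAt.eventually_lt continuousAt_const ?_
    simpa using hlt
  filter_upwards [hunif, hK0] with y hy hyK
  have hsupp : ∀ x, x ∉ tsupport f + K → ‖f (x - y) - f x‖ = 0 := by
    intro x hx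
    have h1 : f x = 0 := by
      by_contra h
      exact hx ⟨x, subset_tsupport f h, 0, mem_of_mem_nhds hK0, add_zero x⟩
    have h2 : f (x - y) = 0 := by
      by_contra h
      exact hx ⟨x - y, subset_tsupport f h, y, hyK, sub_add_cancel x y⟩
    simp [h1, h2]
  rw [← setIntegral_eq_integral_of_forall_compl_eq_zero hsupp, dist_zero_right,
    Real.norm_of_nonneg (integral_nonneg fun _ => norm_nonneg _)]
  have hle : ∫ x in tsupport f + K, ‖f (x - y) - f x‖ ∂μ ≤ (ε / (2 * (c + 1))) * c := by
    have := norm_setIntegral_le_of_norm_le_const (μ := μ) (s := tsupport f + K)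
      (f := fun x => ‖f (x - y) - f x‖) (C := ε / (2 * (c + 1))) hcK.measure_lt_top
      (fun x hx => by simpa using (hy x hx).le)
    exact (le_abs_self _).trans this
  refine hle.trans_lt ?_
  rw [div_mul_eq_mul_div, div_lt_iff₀ (by positivity)]
  nlinarith

/-- By invariance of the measure, composing with `τ y` replaces `f` by its translate. This upgrades
the strong continuity of `τ` to norm continuity at 0 after multiplication by the convolution
operator. -/
theorem norm_convOperator_mul_sub_le (τ : G → H →L[ℂ] H) (hτ : ∀ h, Continuous fun x => τ x h)
    (hn : ∀ x h, ‖τ x h‖ = ‖h‖) (hadd : ∀ x y, τ (x + y) = τ x * τ y) (μ : Measure G)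
    [μ.IsAddHaarMeasure] (f : G → ℂ) (hf : Continuous f) (hfs : HasCompactSupport f) (y : G) :
    ‖convOperator τ hτ hn μ f hf hfs * τ y - convOperator τ hτ hn μ f hf hfs‖ ≤
      ∫ x, ‖f (x - y) - f x‖ ∂μ := by
  refine ContinuousLinearMap.opNorm_le_bound _ (integral_nonneg fun _ => norm_nonneg _) fun h => ?_
  have hf' : Continuous fun x => f (x - y) := by fun_prop
  have hfs' : HasCompactSupport fun x => f (x - y) :=
    hfs.comp_homeomorph (Homeomorph.subRight y)
  have h1 : (convOperator τ hτ hn μ f hf hfs * τ y - convOperator τ hτ hn μ f hf hfs) h =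
      ∫ x, (f (x - y) - f x) • τ x h ∂μ := by
    simp only [sub_smul]
    rw [integral_sub (integrable_smul_of_compactSupport hf' hfs' μ (hτ h))
      (integrable_smul_of_compactSupport hf hfs μ (hτ h)),
      ← integral_add_right_eq_self (fun x => f (x - y) • τ x h) y]
    simp only [add_sub_cancel_right, hadd]
    rfl
  rw [h1]
  refine (norm_integral_le_integral_norm _).trans ?_
  simp only [norm_smul, hn]
  rw [integral_mul_const]

/-- Convolution with an approximate identity does not annihilate a given non-zero vector. -/
theorem exists_convOperator_apply_ne_zero (τ : G → H →L[ℂ] H)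
    (hτ : ∀ h, Continuous fun x => τ x h) (h0 : τ 0 = 1)
    (hn : ∀ x h, ‖τ x h‖ = ‖h‖) (μ : Measure G) [μ.IsAddHaarMeasure] (k : H) (hk : k ≠ 0) :
    ∃ (f : G → ℂ) (hf : Continuous f) (hfs : HasCompactSupport f),
      convOperator τ hτ hn μ f hf hfs k ≠ 0 := by
  have hk' : 0 < ‖k‖ := norm_pos_iff.2 hk
  -- For a bump function supported where `τ` moves `k` by less than half its length, the averaged
  -- vector differs from `(∫ g) k` by at most half the length of the latter.
  let U : Set G := {x | ‖τ x k - k‖ < ‖k‖ / 2}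
  have hU : IsOpen U := isOpen_lt ((hτ k).sub continuous_const).norm continuous_const
  have h0U : (0 : G) ∈ U := by simp [U, h0, hk]
  obtain ⟨g, hg1, hgU, hgs, hg01⟩ := exists_continuous_one_zero_of_isCompact
    (isCompact_singleton (x := (0 : G))) hU.isClosed_compl
    (Set.disjoint_singleton_left.2 fun h => h h0U)
  have hgi : Integrable g μ := g.continuous.integrable_of_hasCompactSupport hgs
  have hc : 0 < ∫ x, g x ∂μ :=
    g.continuous.integral_pos_of_hasCompactSupport_nonneg_nonzero hgs (fun x => (hg01 x).1)
      (x := 0) (by rw [hg1 rfl]; exact one_ne_zero)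
  have hf : Continuous fun x => (g x : ℂ) := by fun_prop
  have hfs : HasCompactSupport fun x => (g x : ℂ) :=
    hgs.comp_left (g := fun r : ℝ => (r : ℂ)) Complex.ofReal_zero
  refine ⟨fun x => (g x : ℂ), hf, hfs, fun hz => ?_⟩
  have h1 : ∫ x, (g x : ℂ) • (τ x k - k) ∂μ = -((∫ x, g x ∂μ : ℝ) : ℂ) • k := by
    simp only [smul_sub]
    rw [integral_sub (integrable_smul_of_compactSupport hf hfs μ (hτ k))
      (integrable_smul_of_compactSupport hf hfs μ continuous_const), integral_smul_const,
      integral_complex_ofReal, neg_smul]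
    rw [convOperator_apply] at hz
    rw [hz, zero_sub]
  have h2 : ‖∫ x, (g x : ℂ) • (τ x k - k) ∂μ‖ ≤ ∫ x, g x * (‖k‖ / 2) ∂μ := by
    refine norm_integral_le_of_norm_le (hgi.mul_const _) (Eventually.of_forall fun x => ?_)
    rw [norm_smul, Complex.norm_real, Real.norm_of_nonneg (hg01 x).1]
    by_cases hx : x ∈ U
    · exact mul_le_mul_of_nonneg_left (le_of_lt hx) (hg01 x).1
    · rw [hgU hx]; simp
  rw [h1, integral_mul_const, norm_smul, norm_neg, Complex.norm_real,
    Real.norm_of_nonneg hc.le] at h2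
  have := mul_pos hc hk'
  linarith

/-- A strongly continuous unitary representation of a locally compact abelian group in which `a`
acts non-trivially yields a continuous character that is non-trivial at `a`. -/
theorem exists_addChar_ne_one_of_representation
    (τ : G → H →L[ℂ] H) (hτ : ∀ h, Continuous fun x => τ x h) (h0 : τ 0 = 1)
    (hadd : ∀ x y, τ (x + y) = τ x * τ y) (hn : ∀ x h, ‖τ x h‖ = ‖h‖)
    (a : G) (ha : τ a ≠ 1) : ∃ χ : AddChar G Circle, Continuous χ ∧ χ a ≠ 1 := by
  let μ : Measure G := Measure.addHaar
  have hcomm : ∀ x y, τ x * τ y = τ y * τ x := fun x y => by rw [← hadd, ← hadd, add_comm]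
  have hstar : ∀ x, star (τ x) = τ (-x) := fun x => by
    have h1 : star (τ x) * τ x = 1 :=
      (ContinuousLinearMap.norm_map_iff_adjoint_comp_self (τ x)).1 (hn x)
    calc star (τ x) = star (τ x) * (τ x * τ (-x)) := by rw [← hadd, add_neg_cancel, h0, mul_one]
      _ = τ (-x) := by rw [← mul_assoc, h1, one_mul]
  obtain ⟨h, hh⟩ : ∃ h, τ a h - h ≠ 0 := by
    by_contra! hc
    exact ha (ContinuousLinearMap.ext fun h => by simpa [sub_eq_zero] using hc h)
  set k := τ a h - h with hk
  obtain ⟨f, hf, hfs, hfk⟩ := exists_convOperator_apply_ne_zero τ hτ h0 hn μ k hh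
  set T := convOperator τ hτ hn μ f hf hfs with hT
  have hTτ : ∀ x, τ x * T = T * τ x := fun x =>
    commute_convOperator τ hτ hn μ f hf hfs (τ x) fun y => hcomm x y
  have hsT : ∀ x, star T * τ x = τ x * star T := fun x => by
    have := congrArg star (hTτ (-x))
    simpa [hstar] using this
  obtain ⟨S, hsS, hS⟩ := exists_starSubalgebra_characters_separating (insert T (Set.range τ))
    (by
      rintro _ (rfl | ⟨x, rfl⟩) _ (rfl | ⟨y, rfl⟩)
      · rfl
      · exact (hTτ y).symm
      · exact hTτ x
      · exact hcomm x y)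
    (by
      rintro _ (rfl | ⟨x, rfl⟩) _ (rfl | ⟨y, rfl⟩)
      · exact (commute_convOperator τ hτ hn μ f hf hfs (star T) hsT).symm
      · rw [hstar, hTτ]
      · rw [hsT]
      · rw [hstar, hcomm])
  let T' : S := ⟨T, hsS (Set.mem_insert _ _)⟩
  let t : G → S := fun x => ⟨τ x, hsS (Set.mem_insert_of_mem _ ⟨x, rfl⟩)⟩
  have ht0 : t 0 = 1 := Subtype.ext h0
  have htadd : ∀ x y, t (x + y) = t x * t y := fun x y => Subtype.ext (hadd x y)
  -- One character must not vanish on both factors: `φ T' ≠ 0` gives continuity of `x ↦ φ (t x)`,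
  -- because `T * τ x` is norm continuous at 0, and `φ (t a) ≠ 1` gives non-triviality at `a`.
  obtain ⟨φ, hφ, hφn⟩ := hS (T' * (t a - 1)) (fun h1 => hfk (by
    have := congrArg (fun C : S => (C : H →L[ℂ] H) h) h1
    simpa [T', t, hk] using this))
  rw [map_mul, map_sub, map_one] at hφ
  have hφT : φ T' ≠ 0 := left_ne_zero_of_mul hφ
  have hφa : φ (t a) ≠ 1 := sub_ne_zero.1 (right_ne_zero_of_mul hφ)
  have hnorm : ∀ x, ‖φ (t x)‖ = 1 := by
    intro x
    have h1 : star (t x) * t x = 1 := by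
      rw [← ht0, ← neg_add_cancel x, htadd]
      congr 1
      exact Subtype.ext (hstar x)
    have h2 := congrArg φ h1
    rw [map_mul, map_star, map_one] at h2
    have h3 := congrArg norm h2
    simp only [norm_mul, norm_star, norm_one] at h3
    nlinarith [norm_nonneg (φ (t x))]
  have hmem : ∀ x, φ (t x) ∈ Submonoid.unitSphere ℂ := fun x => by
    simpa [Submonoid.unitSphere] using hnorm x
  let χ : AddChar G Circle :=
    { toFun := fun x => ⟨φ (t x), hmem x⟩
      map_zero_eq_one' := Circle.ext (by simp [ht0])
      map_add_eq_mul' := fun x y => Circle.ext (by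
        change φ (t (x + y)) = φ (t x) * φ (t y)
        rw [htadd, map_mul]) }
  have hχ : ∀ x, (χ x : ℂ) = φ (t x) := fun _ => rfl
  refine ⟨χ, ?_, fun h1 => hφa ?_⟩
  · have hlim : Tendsto (fun y => ‖φ T'‖ * ‖φ (t y) - 1‖) (𝓝 0) (𝓝 0) := by
      refine squeeze_zero (fun _ => by positivity) (fun y => ?_)
        (tendsto_integral_norm_translate_sub μ hf hfs)
      rw [← norm_mul, ← map_one φ, ← map_sub, ← map_mul]
      refine (hφn _).trans (le_trans (le_of_eq ?_)
        (norm_convOperator_mul_sub_le τ hτ hn hadd μ f hf hfs y))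
      rw [mul_sub, mul_one]
      rfl
    have hlim2 : Tendsto (fun y => ‖φ (t y) - 1‖) (𝓝 0) (𝓝 0) := by
      have := hlim.const_mul (‖φ T'‖)⁻¹
      simpa [← mul_assoc, inv_mul_cancel₀ (norm_ne_zero_iff.2 hφT)] using this
    have hat : ContinuousAt (fun x => φ (t x)) 0 := by
      rw [ContinuousAt, tendsto_iff_norm_sub_tendsto_zero]
      simpa [ht0] using hlim2
    refine Continuous.subtype_mk (continuous_iff_continuousAt.2 fun x => ?_) _
    have h3 : (fun y => φ (t y)) = fun y => φ (t x) * φ (t (y - x)) := by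
      ext y
      rw [← map_mul, ← htadd, add_sub_cancel]
    rw [h3]
    refine continuousAt_const.mul ?_
    exact ContinuousAt.comp (g := fun x => φ (t x)) (by simpa using hat)
      (continuousAt_id.sub continuousAt_const)
  · rw [← hχ, h1]; rfl

end Convolution

/-- Continuous characters separate the points of a locally compact abelian group. -/
theorem exists_continuous_addChar_ne_one {G : Type*} [AddCommGroup G] [TopologicalSpace G]
    [IsTopologicalAddGroup G] [T2Space G] [LocallyCompactSpace G] (a : G) (ha : a ≠ 0) :
    ∃ χ : AddChar G Circle, Continuous χ ∧ χ a ≠ 1 := by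
  borelize G
  let μ : Measure G := Measure.addHaar
  have hmp : ∀ x : G, MeasurePreserving (fun y => x + y) μ μ := measurePreserving_add_left μ
  let τ : G → Lp ℂ 2 μ →L[ℂ] Lp ℂ 2 μ := fun x =>
    (Lp.compMeasurePreservingₗᵢ ℂ (fun y => x + y) (hmp x)).toContinuousLinearMap
  have hτapp : ∀ x h, τ x h = Lp.compMeasurePreserving (fun y => x + y) (hmp x) h := fun _ _ => rfl
  have hcongr : ∀ {f g : G → G} (_ : ∀ y, f y = g y) (hf : MeasurePreserving f μ μ)
      (hg : MeasurePreserving g μ μ) (h : Lp ℂ 2 μ),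
      Lp.compMeasurePreserving f hf h = Lp.compMeasurePreserving g hg h := by
    intro f g hfg hf hg h
    obtain rfl : f = g := funext hfg
    rfl
  refine exists_addChar_ne_one_of_representation τ ?_ ?_ ?_ ?_ a ?_
  · intro h
    simp only [hτapp]
    let g : C(G, C(G, G)) := (ContinuousMap.mk (fun p : G × G => p.1 + p.2) (by fun_prop)).curry
    exact continuous_const.compMeasurePreservingLp g.continuous hmp (by simp)
  · ext1 h
    rw [hτapp, hcongr (zero_add : ∀ y : G, 0 + y = y) (hmp 0) (.id μ) h]
    exact Lp.compMeasurePreserving_id_apply h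
  · intro x y
    ext1 h
    rw [mul_apply_eq_comp, hτapp, hτapp, hτapp, ← Lp.compMeasurePreserving_comp_apply]
    exact hcongr (fun z => by simp only [Function.comp]; abel) _ _ h
  · intro x h
    exact Lp.norm_compMeasurePreserving _ _
  · intro h1
    -- If `a` acted trivially, the indicator of every set of finite measure would be invariant under
    -- `a`. The open set `W` below has finite positive measure and is disjoint from `a + W`.
    obtain ⟨U, V, hU, hV, h0U, haV, hUV⟩ := t2_separation ha.symm
    obtain ⟨K, hK, hK0⟩ := exists_compact_mem_nhds (0 : G)
    let W : Set G := U ∩ (fun y => a + y) ⁻¹' V ∩ interior K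
    have hW : IsOpen W := (hU.inter (hV.preimage (by fun_prop))).inter isOpen_interior
    have h0W : (0 : G) ∈ W := ⟨⟨h0U, by simpa using haV⟩, mem_interior_iff_mem_nhds.2 hK0⟩
    have hWf : μ W ≠ ⊤ :=
      ((measure_mono (Set.inter_subset_right.trans interior_subset)).trans_lt
        hK.measure_lt_top).ne
    have hW0 : μ W ≠ 0 := (hW.measure_pos μ ⟨0, h0W⟩).ne'
    let h : Lp ℂ 2 μ := indicatorConstLp 2 hW.measurableSet hWf (1 : ℂ)
    have h2 : Lp.compMeasurePreserving (fun y => a + y) (hmp a) h = h := by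
      rw [← hτapp, h1]; rfl
    have h3 := Lp.coeFn_compMeasurePreserving h (hmp a)
    rw [h2] at h3
    have h4 : h =ᵐ[μ] W.indicator fun _ => (1 : ℂ) := indicatorConstLp_coeFn
    have h5 := (hmp a).quasiMeasurePreserving.ae_eq_comp h4
    have h6 := (h4.symm.trans h3).trans h5
    refine hW0 (measure_mono_null (fun y hy => ?_) (ae_iff.1 h6))
    have hay : a + y ∉ W := fun h7 =>
      Set.disjoint_left.1 hUV h7.1.1 hy.1.2
    simp [Set.indicator_of_mem hy, Set.indicator_of_notMem hay]

/-! ### Small compact subgroups as local kernels of characters -/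

section SmallSubgroups

variable {G : Type*} [AddCommGroup G] [TopologicalSpace G] [IsTopologicalAddGroup G]

/-- Finitely many continuous characters have no common non-trivial zero near the origin. -/
def HasLocallySeparatingCharacters (G : Type*) [AddCommGroup G] [TopologicalSpace G] : Prop :=
  ∃ (k : ℕ) (χ : Fin k → AddChar G Circle), (∀ i, Continuous (χ i)) ∧
    ∃ U ∈ 𝓝 (0 : G), ∀ x ∈ U, (∀ i, χ i x = 1) → x = 0

/-- Every neighbourhood of `0` contains a compact symmetric neighbourhood `K` together with an open
symmetric neighbourhood `V` with `V + V ⊆ K`. -/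
theorem exists_compact_symm_nhds_add_subset [T2Space G] [LocallyCompactSpace G] {U : Set G}
    (hU : U ∈ 𝓝 (0 : G)) :
    ∃ K V : Set G, IsCompact K ∧ IsOpen V ∧ (0 : G) ∈ V ∧ K ⊆ U ∧ V ⊆ K ∧
      (∀ x ∈ K, -x ∈ K) ∧ (∀ x ∈ V, -x ∈ V) ∧ ∀ x ∈ V, ∀ y ∈ V, x + y ∈ K := by
  obtain ⟨K₀, hK₀, hK₀U, hK₀c⟩ := local_compact_nhds hU
  let K := K₀ ∩ -K₀
  have hneg : -K₀ ∈ 𝓝 (0 : G) := by simpa using neg_mem_nhds_zero G hK₀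
  have hK0 : K ∈ 𝓝 (0 : G) := inter_mem hK₀ hneg
  obtain ⟨V₀, hV₀, h0V₀, hVV⟩ := exists_open_nhds_zero_half hK0
  refine ⟨K, V₀ ∩ -V₀, hK₀c.inter_right hK₀c.isClosed.neg, hV₀.inter hV₀.neg,
    ⟨h0V₀, by simpa using h0V₀⟩, fun x hx => hK₀U hx.1, fun x hx => ?_, fun x hx => ?_,
    fun x hx => ?_, fun x hx y hy => hVV x hx.1 y hy.1⟩
  · simpa using hVV x hx.1 0 h0V₀
  · exact ⟨hx.2, by simpa using hx.1⟩
  · exact ⟨hx.2, by simpa using hx.1⟩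

/-- Every neighbourhood of `0` contains a compact subgroup which is locally the common kernel of
finitely many continuous characters. -/
theorem exists_compact_addSubgroup_eq_common_kernel [T2Space G] [LocallyCompactSpace G] {U : Set G}
    (hU : U ∈ 𝓝 (0 : G)) :
    ∃ (N : AddSubgroup G) (k : ℕ) (χ : Fin k → AddChar G Circle), (∀ i, Continuous (χ i)) ∧
      IsCompact (N : Set G) ∧ (N : Set G) ⊆ U ∧ ∃ K ∈ 𝓝 (0 : G),
        ∀ x, x ∈ N ↔ x ∈ K ∧ ∀ i, χ i x = 1 := by
  obtain ⟨K, V, hK, hV, h0V, hKU, hVK, hKs, hVs, hVV⟩ := exists_compact_symm_nhds_add_subset hU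
  -- Finitely many characters are jointly non-trivial at each point of this compact shell. Their
  -- common kernel in `K` therefore lies in `V`, and `V + V ⊆ K` makes it a subgroup.
  have hcomp : IsCompact (K \ V) := hK.diff hV
  have hne : ∀ x ∈ K \ V, x ≠ 0 := fun x hx h => hx.2 (h ▸ h0V)
  choose! ψ hψc hψ using fun x : G => exists_continuous_addChar_ne_one x
  obtain ⟨t, ht⟩ := hcomp.elim_nhds_subcover' (fun x _ => {y | ψ x y ≠ 1}) (fun x hx =>
    (isOpen_ne_fun (hψc x (hne x hx)) continuous_const).mem_nhds (hψ x (hne x hx)))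
  let e := t.equivFin
  let χ : Fin t.card → AddChar G Circle := fun i => ψ (e.symm i).1.1
  have hχ : ∀ i, Continuous (χ i) := fun i => hψc _ (hne _ (e.symm i).1.2)
  have hker : ∀ x ∈ K, (∀ i, χ i x = 1) → x ∈ V := by
    intro x hx h1
    by_contra hxV
    obtain ⟨y, hy, hxy⟩ := Set.mem_iUnion₂.1 (ht ⟨hx, hxV⟩)
    exact hxy (by simpa [χ] using h1 (e ⟨y, hy⟩))
  let N : AddSubgroup G :=
    { carrier := {x | x ∈ K ∧ ∀ i, χ i x = 1}
      add_mem' := fun {x y} hx hy =>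
        ⟨hVV x (hker x hx.1 hx.2) y (hker y hy.1 hy.2), fun i => by
          rw [AddChar.map_add_eq_mul, hx.2 i, hy.2 i, mul_one]⟩
      zero_mem' := ⟨hVK h0V, fun i => AddChar.map_zero_eq_one _⟩
      neg_mem' := fun {x} hx => ⟨hKs x hx.1, fun i => by
        rw [AddChar.map_neg_eq_inv, hx.2 i, inv_one]⟩ }
  refine ⟨N, _, χ, hχ, ?_, fun x hx => hKU hx.1, K, mem_of_superset (hV.mem_nhds h0V) hVK,
    fun x => Iff.rfl⟩
  have hc : IsClosed {x | ∀ i, χ i x = 1} := by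
    simp only [Set.ofPred_forall]
    exact isClosed_iInter fun i => isClosed_eq (hχ i) continuous_const
  exact hK.inter_right hc

/-- A locally compact abelian group in which some neighbourhood of `0` contains no non-trivial
compact subgroup has locally separating characters. -/
theorem hasLocallySeparatingCharacters_of_forall_compact [T2Space G] [LocallyCompactSpace G]
    {U : Set G} (hU : U ∈ 𝓝 (0 : G))
    (h : ∀ N : AddSubgroup G, IsCompact (N : Set G) → (N : Set G) ⊆ U → N = ⊥) :
    HasLocallySeparatingCharacters G := by
  obtain ⟨N, k, χ, hχ, hN, hNU, K, hK, hNK⟩ := exists_compact_addSubgroup_eq_common_kernel hU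
  refine ⟨k, χ, hχ, K, hK, fun x hx h1 => ?_⟩
  have : x ∈ N := (hNK x).2 ⟨hx, h1⟩
  rw [h N hN hNU] at this
  simpa using this

/-- Every neighbourhood of `0` contains a compact subgroup whose quotient has locally separating
characters. -/
theorem exists_compact_addSubgroup_quotient [T2Space G] [LocallyCompactSpace G] {U : Set G}
    (hU : U ∈ 𝓝 (0 : G)) :
    ∃ N : AddSubgroup G, IsCompact (N : Set G) ∧ (N : Set G) ⊆ U ∧
      HasLocallySeparatingCharacters (G ⧸ N) := by
  obtain ⟨N, k, χ, hχ, hN, hNU, K, hK, hNK⟩ := exists_compact_addSubgroup_eq_common_kernel hU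
  refine ⟨N, hN, hNU, k, fun i => AddChar.toAddMonoidHomEquiv.symm
    (QuotientAddGroup.lift N (χ i).toAddMonoidHom fun x hx => ?_), fun i => ?_,
    (↑) '' K, QuotientAddGroup.isOpenMap_coe.image_mem_nhds hK, ?_⟩
  · exact congrArg Additive.ofMul (((hNK x).1 hx).2 i)
  · exact continuous_quot_lift _ (hχ i)
  · rintro _ ⟨x, hx, rfl⟩ h1
    exact (QuotientAddGroup.eq_zero_iff x).2 ((hNK x).2 ⟨hx, fun i => h1 i⟩)

end SmallSubgroups

/-- A closed local subgroup of a finite-dimensional real vector space agrees with a linear subspace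
near the origin. -/
theorem exists_submodule_eq_near_zero {E : Type*} [NormedAddCommGroup E] [NormedSpace ℝ E]
    [FiniteDimensional ℝ E] {S : Set E} {r : ℝ} (hr : 0 < r) (hS : IsClosed S) (h0 : (0 : E) ∈ S)
    (hneg : ∀ a ∈ S, -a ∈ S) (hadd : ∀ a ∈ S, ∀ b ∈ S, ‖a + b‖ ≤ r → a + b ∈ S) :
    ∃ (L : Submodule ℝ E) (ε : ℝ), 0 < ε ∧ ε ≤ r ∧ ∀ v, ‖v‖ ≤ ε → (v ∈ S ↔ v ∈ L) := by
  have hmul : ∀ a ∈ S, ∀ k : ℕ, k * ‖a‖ ≤ r → (k : ℝ) • a ∈ S := by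
    intro a ha k
    induction k with
    | zero => intro _; simpa using h0
    | succ k ih =>
      intro hk
      push_cast at hk ⊢
      have hk' : k * ‖a‖ ≤ r := by nlinarith [norm_nonneg a]
      rw [add_smul, one_smul]
      refine hadd _ (ih hk') _ ha ?_
      refine (norm_add_le _ _).trans ?_
      rw [norm_smul, Real.norm_of_nonneg (Nat.cast_nonneg k)]
      linarith
  -- The tangent directions of `S` at 0.
  let L : Submodule ℝ E :=
    { carrier := {v | ∀ᶠ t in 𝓝 (0 : ℝ), t • v ∈ S}
      zero_mem' := by simp [h0]
      add_mem' := by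
        intro a b ha hb
        have hsmall : ∀ᶠ t in 𝓝 (0 : ℝ), ‖t • (a + b)‖ < r := by
          have : Continuous fun t : ℝ => ‖t • (a + b)‖ := by fun_prop
          exact this.continuousAt.eventually_lt continuousAt_const (by simpa using hr)
        filter_upwards [ha, hb, hsmall] with t h1 h2 h3
        rw [smul_add] at h3 ⊢
        exact hadd _ h1 _ h2 h3.le
      smul_mem' := by
        intro c v hv
        have : Tendsto (fun t : ℝ => t * c) (𝓝 0) (𝓝 0) := by
          simpa using (continuous_mul_const c).tendsto (0 : ℝ)
        filter_upwards [this.eventually hv] with t ht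
        rwa [smul_smul] }
  have hLS : ∀ v ∈ L, ‖v‖ ≤ r → v ∈ S := by
    intro v hv hvr
    obtain ⟨n, hn⟩ := (tendsto_one_div_add_atTop_nhds_zero_nat (𝕜 := ℝ).eventually hv).exists
    have hn0 : (0 : ℝ) < (n : ℝ) + 1 := by positivity
    have h1 := hmul _ hn (n + 1) (by
      rw [norm_smul, Real.norm_of_nonneg (by positivity)]
      push_cast
      rw [← mul_assoc, mul_one_div_cancel hn0.ne', one_mul]
      exact hvr)
    push_cast at h1
    rwa [smul_smul, mul_one_div_cancel hn0.ne', one_smul] at h1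
  refine ⟨L, ?_⟩
  -- Otherwise points `s n` of `S` outside `L` tend to 0. Subtracting their projections to `L` gives
  -- `u n ∈ S` for large `n`, whose normalised limit `w` satisfies `p w = 0`; it will also lie in
  -- `L`, contradicting `‖w‖ = 1`.
  by_contra! hcon
  have hex : ∀ n : ℕ, ∃ v, ‖v‖ ≤ r / (n + 1) ∧ v ∈ S ∧ v ∉ L := by
    intro n
    have hrn : r / (n + 1) ≤ r := div_le_self hr.le (by linarith [n.cast_nonneg (α := ℝ)])
    obtain ⟨v, hv, h⟩ := hcon (r / (n + 1)) (by positivity) hrn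
    rcases h with h | h
    · exact ⟨v, hv, h⟩
    · exact absurd (hLS v h.2 (hv.trans hrn)) h.1
  choose s hs hsS hsL using hex
  obtain ⟨p, hp⟩ := Submodule.ClosedComplemented.of_finiteDimensional L
  have hs0 : Tendsto s atTop (𝓝 0) := by
    refine squeeze_zero_norm hs ?_
    have := (tendsto_one_div_add_atTop_nhds_zero_nat (𝕜 := ℝ)).const_mul r
    simpa [div_eq_mul_inv] using this
  let u : ℕ → E := fun n => s n - p (s n)
  have hpE : Continuous fun x => ((p x : L) : E) := by fun_prop
  have hps0 : Tendsto (fun n => ((p (s n) : L) : E)) atTop (𝓝 0) := by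
    simpa [Function.comp_def] using (hpE.tendsto 0).comp hs0
  have hu0 : Tendsto u atTop (𝓝 0) := by simpa using hs0.sub hps0
  have hune : ∀ n, u n ≠ 0 := fun n h => hsL n (by
    rw [sub_eq_zero.1 h]; exact (p (s n)).2)
  have hpu : ∀ n, p (u n) = 0 := fun n => by simp [u, hp]
  have hsmall : ∀ {x : ℕ → E}, Tendsto x atTop (𝓝 0) → ∀ᶠ n in atTop, ‖x n‖ ≤ r := by
    intro x hx
    have := hx.norm
    rw [norm_zero] at this
    exact this.eventually_le_const hr
  have huS : ∀ᶠ n in atTop, u n ∈ S := by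
    filter_upwards [hsmall hps0, hsmall hu0] with n h1 h2
    have := hneg _ (hLS _ (p (s n)).2 h1)
    simp only [u, sub_eq_add_neg] at h2 ⊢
    exact hadd _ (hsS n) _ this h2
  obtain ⟨w, hw, φ, hφ, hlim⟩ := (isCompact_sphere (0 : E) 1).tendsto_subseq
    (x := fun n => ‖u n‖⁻¹ • u n) (fun n => by
      simp [norm_smul, inv_mul_cancel₀ (norm_ne_zero_iff.2 (hune n))])
  have hpw : p w = 0 := by
    have h1 := (p.continuous.tendsto w).comp hlim
    have h2 : (p ∘ (fun n => ‖u n‖⁻¹ • u n) ∘ φ) = fun _ => 0 := by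
      ext n
      simp [hpu]
    rw [h2] at h1
    exact (tendsto_nhds_unique h1 tendsto_const_nhds)
  -- The integer multiples `⌊t / ‖u n‖⌋ • u n` lie in `S` and tend to `t • w` along the subsequence,
  -- since the step length tends to 0.
  have hpos : ∀ t : ℝ, 0 ≤ t → t ≤ r → t • w ∈ S := by
    intro t ht htr
    have huφ : Tendsto (fun n => ‖u (φ n)‖) atTop (𝓝 0) := by
      simpa using (hu0.comp hφ.tendsto_atTop).norm
    have hfl : ∀ n, (⌊t / ‖u (φ n)‖⌋₊ : ℝ) * ‖u (φ n)‖ ≤ t := fun n => by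
      have hu := norm_pos_iff.2 (hune (φ n))
      rw [← le_div_iff₀ hu]
      exact Nat.floor_le (by positivity)
    have hfloor : Tendsto (fun n => (⌊t / ‖u (φ n)‖⌋₊ : ℝ) * ‖u (φ n)‖) atTop (𝓝 t) := by
      refine tendsto_of_tendsto_of_tendsto_of_le_of_le (g := fun n => t - ‖u (φ n)‖)
        (h := fun _ => t) (by simpa using huφ.const_sub t) tendsto_const_nhds (fun n => ?_) hfl
      have hu := norm_pos_iff.2 (hune (φ n))
      have := (Nat.lt_floor_add_one (t / ‖u (φ n)‖)).le
      rw [div_le_iff₀ hu] at this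
      simp only
      linarith
    refine hS.mem_of_tendsto (hfloor.smul hlim) ?_
    filter_upwards [hφ.tendsto_atTop.eventually huS] with n hn
    have h1 := hmul _ hn ⌊t / ‖u (φ n)‖⌋₊ ((hfl n).trans htr)
    simpa [smul_smul, mul_assoc, mul_inv_cancel₀ (norm_ne_zero_iff.2 (hune (φ n)))] using h1
  have hwL : w ∈ L := by
    have : ∀ᶠ t in 𝓝 (0 : ℝ), |t| < r := by
      have := (continuous_abs.tendsto (0 : ℝ)).eventually_lt_const (u := r) (by simpa using hr)
      exact this
    filter_upwards [this] with t ht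
    rcases le_total 0 t with h | h
    · exact hpos t h (by rw [abs_of_nonneg h] at ht; exact ht.le)
    · have := hneg _ (hpos (-t) (by linarith) (by rw [abs_of_nonpos h] at ht; exact ht.le))
      simpa using this
  have h1 := hp ⟨w, hwL⟩
  rw [hpw] at h1
  have : w = 0 := (congrArg Subtype.val h1).symm
  simp [this] at hw

/-- An additive map on a ball of a real normed space extends to a group homomorphism. -/
theorem exists_addMonoidHom_eq_on_ball {V G : Type*} [NormedAddCommGroup V] [NormedSpace ℝ V]
    [AddCommGroup G] {ε : ℝ} (hε : 0 < ε) (j : V → G)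
    (hj : ∀ v w, ‖v‖ ≤ ε → ‖w‖ ≤ ε → ‖v + w‖ ≤ ε → j (v + w) = j v + j w) :
    ∃ E : V →+ G, ∀ v, ‖v‖ ≤ ε → E v = j v := by
  have hj0 : j 0 = 0 := by simpa [hε.le] using hj 0 0
  have hmul : ∀ (n : ℕ) (v : V), n * ‖v‖ ≤ ε → j ((n : ℝ) • v) = n • j v := by
    intro n v
    induction n with
    | zero => intro _; simp [hj0]
    | succ n ih =>
      intro hn
      have hnn : ‖((n : ℝ) + 1) • v‖ = (n + 1) * ‖v‖ := by
        rw [norm_smul, Real.norm_of_nonneg (by positivity)]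
      push_cast at hn ⊢
      have h1 : n * ‖v‖ ≤ ε := by nlinarith [norm_nonneg v]
      have h2 : ‖v‖ ≤ ε := by
        nlinarith [norm_nonneg v, mul_nonneg (n.cast_nonneg (α := ℝ)) (norm_nonneg v)]
      have h3 := hnn
      rw [add_smul, one_smul] at h3 ⊢
      rw [hj _ _ (by rwa [norm_smul, Real.norm_of_nonneg (by positivity)]) h2 (h3.trans_le hn),
        ih h1, succ_nsmul]
  -- The extension is `N • j (v / N)` for `N` large enough that `v / N` lies in the ball; two
  -- choices of `N` are compared through their product. The `+ 1` keeps `N` positive.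
  let N : V → ℕ := fun v => ⌈‖v‖ / ε⌉₊ + 1
  have hN : ∀ v, ‖v‖ ≤ N v * ε := fun v => by
    rw [← div_le_iff₀ hε]
    exact (Nat.le_ceil _).trans (by simp [N])
  have hN0 : ∀ v, (0 : ℝ) < N v := fun v => by positivity
  have hdiv : ∀ (n m : ℕ) (v : V), 0 < n → 0 < m → ‖v‖ ≤ n * ε →
      n • j ((n : ℝ)⁻¹ • v) = (n * m) • j (((n : ℝ) * m)⁻¹ • v) := by
    intro n m v hn hm hv
    have hn' : (0 : ℝ) < n := Nat.cast_pos.2 hn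
    have hm' : (0 : ℝ) < m := Nat.cast_pos.2 hm
    have h1 := hmul m (((n : ℝ) * m)⁻¹ • v) (by
      rw [norm_smul, Real.norm_of_nonneg (by positivity), mul_inv, ← mul_assoc,
        mul_comm (m : ℝ), mul_assoc (n : ℝ)⁻¹, inv_mul_cancel₀ hm'.ne', mul_one,
        inv_mul_le_iff₀ hn']
      exact hv)
    rw [smul_smul, mul_inv, mul_comm (n : ℝ)⁻¹, ← mul_assoc, mul_inv_cancel₀ hm'.ne', one_mul] at h1
    rw [h1, mul_inv, mul_comm (n : ℝ)⁻¹, smul_smul n m]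
  have key : ∀ (n : ℕ) (v : V), 0 < n → ‖v‖ ≤ n * ε →
      n • j ((n : ℝ)⁻¹ • v) = N v • j ((N v : ℝ)⁻¹ • v) := by
    intro n v hn hv
    rw [hdiv n (N v) v hn (Nat.succ_pos _) hv, hdiv (N v) n v (Nat.succ_pos _) hn (hN v),
      mul_comm n, mul_comm (n : ℝ)]
  refine ⟨AddMonoidHom.mk' (fun v => N v • j ((N v : ℝ)⁻¹ • v)) fun v w => ?_, fun v hv => ?_⟩
  · have hle : ∀ {x : V}, ‖x‖ ≤ ‖v‖ + ‖w‖ → ‖x‖ ≤ ((N v + N w : ℕ) : ℝ) * ε := fun h => by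
      push_cast; linarith [hN v, hN w]
    have hpos : 0 < N v + N w := by simp [N]
    have hposR : (0 : ℝ) < ((N v + N w : ℕ) : ℝ) := Nat.cast_pos.2 hpos
    have hsm : ∀ {x : V}, ‖x‖ ≤ ‖v‖ + ‖w‖ → ‖((N v + N w : ℕ) : ℝ)⁻¹ • x‖ ≤ ε := fun h => by
      rw [norm_smul, Real.norm_of_nonneg (by positivity), inv_mul_le_iff₀ hposR]
      exact hle h
    have hv := norm_nonneg v
    have hw := norm_nonneg w
    have h1 : ‖v‖ ≤ ‖v‖ + ‖w‖ := by linarith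
    have h2 : ‖w‖ ≤ ‖v‖ + ‖w‖ := by linarith
    have h3 := norm_add_le v w
    rw [← key _ _ hpos (hle h1), ← key _ _ hpos (hle h2), ← key _ _ hpos (hle h3), smul_add,
      hj _ _ (hsm h1) (hsm h2) (by rw [← smul_add]; exact hsm h3), smul_add]
  · have := key 1 v one_pos (by simpa using hv)
    simpa using this.symm

/-! ### Logarithmic coordinates and the exponential map -/

section Exponential

variable {G : Type*} [AddCommGroup G]

/-- The logarithmic coordinates given by a finite family of characters. -/
noncomputable def argCoord {k : ℕ} (χ : Fin k → AddChar G Circle) (x : G) : Fin k → ℝ :=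
  fun i => Complex.arg (χ i x)

variable {k : ℕ} {χ : Fin k → AddChar G Circle} {x y : G}

theorem abs_argCoord_lt (hx : ‖argCoord χ x‖ < 1) (i : Fin k) : |Complex.arg (χ i x)| < 1 :=
  (norm_le_pi_norm (argCoord χ x) i).trans_lt hx

/-- Two arguments below 1 in absolute value have a sum strictly between -π and π, so no wrap-around
occurs. -/
theorem argCoord_add (hx : ‖argCoord χ x‖ < 1) (hy : ‖argCoord χ y‖ < 1) :
    argCoord χ (x + y) = argCoord χ x + argCoord χ y := by
  ext i
  have h1 := abs_lt.1 (abs_argCoord_lt hx i)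
  have h2 := abs_lt.1 (abs_argCoord_lt hy i)
  have h3 := Real.pi_gt_three
  simp only [argCoord, Pi.add_apply, AddChar.map_add_eq_mul, Circle.coe_mul]
  exact Complex.arg_mul (Circle.coe_ne_zero _) (Circle.coe_ne_zero _)
    ⟨by linarith, by linarith⟩

theorem argCoord_neg (hx : ‖argCoord χ x‖ < 1) : argCoord χ (-x) = -argCoord χ x := by
  ext i
  have h1 := abs_lt.1 (abs_argCoord_lt hx i)
  have h3 := Real.pi_gt_three
  simp only [argCoord, Pi.neg_apply, AddChar.map_neg_eq_inv, Circle.coe_inv]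
  rw [Complex.arg_inv, if_neg (by linarith)]

theorem argCoord_zero : argCoord χ 0 = 0 := by
  ext i
  simp [argCoord]

theorem eq_one_of_argCoord_eq_zero (hx : argCoord χ x = 0) (i : Fin k) : χ i x = 1 := by
  apply Circle.injective_arg
  simpa [argCoord] using congrFun hx i

variable [TopologicalSpace G]

theorem continuousAt_argCoord (hχ : ∀ i, Continuous (χ i)) (hx : ‖argCoord χ x‖ < 1) :
    ContinuousAt (argCoord χ) x := by
  refine continuousAt_pi.2 fun i => ?_
  have h1 := abs_lt.1 (abs_argCoord_lt hx i)
  have h3 := Real.pi_gt_three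
  refine ContinuousAt.comp (g := Complex.arg) (Complex.continuousAt_arg ?_)
    (continuous_subtype_val.comp (hχ i)).continuousAt
  exact Complex.mem_slitPlane_iff_arg.2 ⟨by linarith, Circle.coe_ne_zero _⟩

/-- A locally compact abelian group with locally separating characters is locally isomorphic to
a finite-dimensional real vector space. -/
theorem exists_exponential [IsTopologicalAddGroup G] [T2Space G] [LocallyCompactSpace G]
    (hG : HasLocallySeparatingCharacters G) :
    ∃ (n : ℕ) (E : (Fin n → ℝ) →+ G), Continuous E ∧ IsOpenMap E ∧
      ∃ ε > 0, ∀ v, ‖v‖ < ε → E v = 0 → v = 0 := by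
  obtain ⟨k, χ, hχ, U, hU, hUχ⟩ := hG
  set θ := argCoord χ with hθ
  have hθ0 : θ 0 = 0 := argCoord_zero
  have hθc0 : ContinuousAt θ 0 := continuousAt_argCoord hχ (by simp [argCoord_zero])
  have hball : ∀ δ > 0, ∀ᶠ x in 𝓝 (0 : G), ‖θ x‖ < δ := fun δ hδ =>
    hθc0.norm.eventually_lt continuousAt_const (by simpa [hθ0] using hδ)
  obtain ⟨K, V, hK, hV, h0V, hKU, hVK, hKs, hVs, hVV⟩ :=
    exists_compact_symm_nhds_add_subset (inter_mem hU (hball 1 one_pos))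
  have hK1 : ∀ x ∈ K, ‖θ x‖ < 1 := fun x hx => (hKU hx).2
  have hK0 : ∀ x ∈ K, θ x = 0 → x = 0 := fun x hx h =>
    hUχ x (hKU hx).1 fun i => eq_one_of_argCoord_eq_zero h i
  have hθK : ContinuousOn θ K := fun x hx =>
    (continuousAt_argCoord hχ (hK1 x hx)).continuousWithinAt
  -- On the compact set `K \ W` the norm of `θ` has a positive minimum. This provides continuity at
  -- 0 of the local inverse of `θ`.
  have hfar : ∀ W : Set G, IsOpen W → (0 : G) ∈ W → ∃ δ > 0, ∀ x ∈ K, ‖θ x‖ ≤ δ → x ∈ W := by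
    intro W hW h0W
    rcases (K \ W).eq_empty_or_nonempty with h | h
    · exact ⟨1, one_pos, fun x hx _ => by_contra fun hxW => h.le ⟨hx, hxW⟩⟩
    · obtain ⟨z, hz, hmin⟩ := (hK.diff hW).exists_isMinOn h
        ((hθK.mono Set.sdiff_subset).norm)
      have hzpos : 0 < ‖θ z‖ := norm_pos_iff.2 fun h1 => hz.2 (hK0 z hz.1 h1 ▸ h0W)
      refine ⟨‖θ z‖ / 2, by positivity, fun x hx hxz => by_contra fun hxW => ?_⟩
      have := isMinOn_iff.1 hmin x ⟨hx, hxW⟩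
      linarith
  obtain ⟨r, hr, hrV⟩ := hfar V hV h0V
  -- By the choice of `r`, sums of two elements of `K'` stay in `K`, where `θ` is still faithful; so
  -- `θ '' K'` is a closed local subgroup.
  let K' : Set G := K ∩ {x | ‖θ x‖ ≤ r}
  have hK' : IsCompact K' := by
    refine hK.of_isClosed_subset ?_ Set.inter_subset_left
    exact hθK.norm.preimage_isClosed_of_isClosed hK.isClosed isClosed_Iic
  have hK'V : ∀ x ∈ K', x ∈ V := fun x hx => hrV x hx.1 hx.2
  have hadd : ∀ x ∈ K', ∀ y ∈ K', θ (x + y) = θ x + θ y := fun x hx y hy =>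
    argCoord_add (hK1 x hx.1) (hK1 y hy.1)
  have hneg : ∀ x ∈ K', -x ∈ K' ∧ θ (-x) = -θ x := fun x hx => by
    have := argCoord_neg (hK1 x hx.1)
    refine ⟨⟨hKs x hx.1, ?_⟩, this⟩
    change ‖θ (-x)‖ ≤ r
    rw [hθ, this, norm_neg]
    exact hx.2
  have hmem : ∀ x ∈ K', ∀ y ∈ K', ‖θ x + θ y‖ ≤ r → x + y ∈ K' := fun x hx y hy h =>
    ⟨hVV x (hK'V x hx) y (hK'V y hy), by rw [← hadd x hx y hy] at h; exact h⟩
  have hinj : ∀ x ∈ K', ∀ y ∈ K', θ x = θ y → x = y := fun x hx y hy h => by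
    have h1 := hneg y hy
    have h2 := hadd x hx _ h1.1
    rw [h1.2, h, add_neg_cancel] at h2
    have h3 := hK0 _ (hVV x (hK'V x hx) _ (hK'V _ h1.1)) h2
    rwa [← sub_eq_add_neg, sub_eq_zero] at h3
  obtain ⟨L, ε, hε, hεr, hL⟩ := exists_submodule_eq_near_zero (S := θ '' K') hr
    (hK'.image_of_continuousOn (hθK.mono Set.inter_subset_left)).isClosed
    ⟨0, ⟨hVK h0V, by simp [hθ0, hr.le]⟩, hθ0⟩
    (by rintro _ ⟨x, hx, rfl⟩; exact ⟨-x, hneg x hx⟩)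
    (by
      rintro _ ⟨x, hx, rfl⟩ _ ⟨y, hy, rfl⟩ h
      exact ⟨x + y, hmem x hx y hy h, hadd x hx y hy⟩)
  have hex : ∀ v : L, ∃ x, ‖v‖ ≤ ε → x ∈ K' ∧ θ x = v := fun v => by
    by_cases hv : ‖v‖ ≤ ε
    · obtain ⟨x, hx⟩ := (hL v hv).2 v.2
      exact ⟨x, fun _ => hx⟩
    · exact ⟨0, fun h => absurd h hv⟩
  choose j hj using hex
  obtain ⟨E, hE⟩ := exists_addMonoidHom_eq_on_ball hε j fun v w hv hw hvw => by
    obtain ⟨h1, h1'⟩ := hj v hv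
    obtain ⟨h2, h2'⟩ := hj w hw
    obtain ⟨h3, h3'⟩ := hj _ hvw
    refine hinj _ h3 _ (hmem _ h1 _ h2 ?_) ?_
    · rw [h1', h2']; exact hvw.trans hεr
    · rw [h3', hadd _ h1 _ h2, h1', h2']; rfl
  have hEc : Continuous E := by
    refine continuous_of_continuousAt_zero E ?_
    rw [ContinuousAt, map_zero]
    intro W hW
    obtain ⟨W', hW'W, hW', h0W'⟩ := mem_nhds_iff.1 hW
    obtain ⟨δ, hδ, hδW⟩ := hfar W' hW' h0W'
    rw [mem_map]
    filter_upwards [Metric.ball_mem_nhds (0 : L) (lt_min hδ hε)] with v hv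
    rw [mem_ball_zero_iff, lt_min_iff] at hv
    obtain ⟨h1, h2⟩ := hj v hv.2.le
    change E v ∈ W
    rw [hE v hv.2.le]
    exact hW'W (hδW _ h1.1 (by rw [h2]; exact hv.1.le))
  have hEo : IsOpenMap E := by
    refine IsTopologicalAddGroup.isOpenMap_iff_nhds_zero.2 fun W hW => ?_
    obtain ⟨δ, hδ, hδW⟩ := Metric.mem_nhds_iff.1 hW
    have h1 := hball (min δ ε) (lt_min hδ hε)
    -- Every `x` near 0 is recovered as `E (θ x)`.
    filter_upwards [h1, mem_of_superset (hV.mem_nhds h0V) hVK] with x hx hxK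
    have hxK' : x ∈ K' := ⟨hxK, hx.le.trans ((min_le_right _ _).trans hεr)⟩
    have hxε : ‖θ x‖ ≤ ε := hx.le.trans (min_le_right _ _)
    have hxL : θ x ∈ L := (hL _ hxε).1 ⟨x, hxK', rfl⟩
    have h2 : E ⟨θ x, hxL⟩ = x := by
      rw [hE ⟨θ x, hxL⟩ hxε]
      obtain ⟨h3, h4⟩ := hj ⟨θ x, hxL⟩ hxε
      exact hinj _ h3 _ hxK' h4
    rw [← h2]
    exact hδW (mem_ball_zero_iff.2 (hx.trans_le (min_le_left _ _)))
  let e : (Fin (Module.finrank ℝ L) → ℝ) ≃L[ℝ] L := ContinuousLinearEquiv.ofFinrankEq (by simp)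
  obtain ⟨δ, hδ, hδe⟩ := Metric.mem_nhds_iff.1
    (e.continuous.continuousAt.preimage_mem_nhds (x := 0) (Metric.ball_mem_nhds _ hε))
  refine ⟨Module.finrank ℝ L, E.comp (e : (Fin (Module.finrank ℝ L) → ℝ) →+ L),
    hEc.comp e.continuous, hEo.comp e.toHomeomorph.isOpenMap, δ, hδ, fun v hv hv0 => ?_⟩
  have h1 : ‖e v‖ < ε := by
    have := hδe (mem_ball_zero_iff.2 hv)
    simpa using this
  have h2 : E (e v) = 0 := hv0
  rw [hE _ h1.le] at h2
  have h3 := (hj _ h1.le).2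
  rw [h2, hθ0] at h3
  exact e.map_eq_zero_iff.1 (Subtype.ext h3.symm)

end Exponential

/-! ### The torus spanned by the kernel of the exponential map -/

section Torus

/-- A discrete subgroup of a finite-dimensional real vector space is freely generated by linearly
independent vectors. -/
theorem exists_linearIndependent_generators {V : Type*} [NormedAddCommGroup V] [NormedSpace ℝ V]
    [FiniteDimensional ℝ V] (Λ : Submodule ℤ V) [DiscreteTopology Λ] :
    ∃ (m : ℕ) (b : Fin m → V), LinearIndependent ℝ b ∧
      ∀ v, v ∈ Λ ↔ ∃ c : Fin m → ℤ, v = ∑ i, c i • b i := by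
  let B := Module.finBasis ℤ Λ
  let b : Fin (Module.finrank ℤ Λ) → V := fun i => B i
  have hspan : Submodule.span ℤ (Set.range b) = Λ := by
    have : Set.range b = Λ.subtype '' Set.range B := by rw [← Set.range_comp]; rfl
    rw [this, ← Submodule.map_span, B.span_eq, Submodule.map_top, Submodule.range_subtype]
  refine ⟨_, b, ?_, fun v => ⟨fun hv => ⟨B.repr ⟨v, hv⟩, ?_⟩, ?_⟩⟩
  · rw [linearIndependent_iff_card_eq_finrank_span,
      Real.finrank_eq_int_finrank_of_discrete (by rw [hspan]; infer_instance), Set.finrank, hspan,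
      Fintype.card_fin]
  · have h := congrArg Λ.subtype (B.sum_repr ⟨v, hv⟩)
    simp only [map_sum, map_smul, Submodule.subtype_apply] at h
    exact h.symm
  · rintro ⟨c, rfl⟩
    exact Λ.sum_mem fun i _ => Λ.smul_mem _ (B i).2

variable {G : Type*} [AddCommGroup G] [TopologicalSpace G] [IsTopologicalAddGroup G]

/-- The maximal torus of a group covered by a vector group: it contains all compact elements of the
image and all real multiples of the kernel. -/
theorem exists_maximal_torus {n : ℕ} (E : (Fin n → ℝ) →+ G) (hE : Continuous E)
    (hEo : IsOpenMap E) (hEi : ∃ ε > 0, ∀ v, ‖v‖ < ε → E v = 0 → v = 0) :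
    ∃ (m : ℕ) (F : (Fin m → UnitAddCircle) →+ G), Continuous F ∧ Function.Injective F ∧
      F.range ≤ E.range ∧ (∀ v, E v = 0 → ∀ t : ℝ, E (t • v) ∈ F.range) ∧
      ∀ K : AddSubgroup G, IsCompact (K : Set G) → ∀ v, E v ∈ K → E v ∈ F.range := by
  obtain ⟨ε, hε, hEi⟩ := hEi
  let Λ : Submodule ℤ (Fin n → ℝ) := AddSubgroup.toIntSubmodule E.ker
  have hΛ : ∀ v, v ∈ Λ ↔ E v = 0 := fun v => Iff.rfl
  have : DiscreteTopology Λ := by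
    rw [discreteTopology_iff_isOpen_singleton_zero]
    have h1 : ({0} : Set Λ) = Subtype.val ⁻¹' Metric.ball (0 : Fin n → ℝ) ε := by
      ext v
      simp only [Set.mem_singleton_iff, Set.mem_preimage, mem_ball_zero_iff]
      exact ⟨fun h => by simp [h, hε], fun h => Subtype.ext (hEi _ h v.2)⟩
    rw [h1]
    exact Metric.isOpen_ball.preimage continuous_subtype_val
  obtain ⟨m, b, hb, hbΛ⟩ := exists_linearIndependent_generators Λ
  -- `c` parametrises the real span of the kernel lattice and matches ℤᵐ with that lattice, so `E ∘
  -- c` descends to an injective map `F` on (ℝ/ℤ)ᵐ.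
  let c : (Fin m → ℝ) →ₗ[ℝ] (Fin n → ℝ) := Fintype.linearCombination ℝ b
  have hcapp : ∀ t, c t = ∑ i, t i • b i := fun t => rfl
  have hcc : Continuous c := c.continuous_of_finiteDimensional
  let P : (Fin m → ℝ) →+ G := E.comp c.toAddMonoidHom
  have hP : Continuous P := hE.comp hcc
  let q : (Fin m → ℝ) →+ (Fin m → UnitAddCircle) :=
    { toFun := Pi.map fun _ t => (t : UnitAddCircle)
      map_zero' := rfl
      map_add' := fun _ _ => rfl }
  have hq : IsOpenQuotientMap q := .piMap fun _ => QuotientAddGroup.isOpenQuotientMap_mk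
  have hqP : ∀ t, q t = 0 ↔ P t = 0 := by
    intro t
    have h1 : q t = 0 ↔ ∀ i, ∃ k : ℤ, (k : ℝ) = t i := by
      rw [funext_iff]
      refine forall_congr' fun i => ?_
      change ((t i : UnitAddCircle) = 0) ↔ _
      rw [AddCircle.coe_eq_zero_iff]
      simp
    have h2 : P t = 0 ↔ c t ∈ Λ := Iff.rfl
    rw [h1, h2, hbΛ]
    constructor
    · intro h
      choose k hk using h
      refine ⟨k, ?_⟩
      rw [hcapp]
      refine Finset.sum_congr rfl fun i _ => ?_
      rw [← hk, Int.cast_smul_eq_zsmul]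
    · rintro ⟨k, hk⟩ i
      have h3 : c t = c (fun i => (k i : ℝ)) := by
        rw [hk, hcapp]
        exact Finset.sum_congr rfl fun i _ => (Int.cast_smul_eq_zsmul ℝ _ _).symm
      have h4 := hb.fintypeLinearCombination_injective h3
      exact ⟨k i, (congrFun h4 i).symm⟩
  let F : (Fin m → UnitAddCircle) →+ G :=
    q.liftOfSurjective hq.surjective ⟨P, fun t ht => (hqP t).1 ht⟩
  have hFq : ∀ t, F (q t) = P t := fun t =>
    q.liftOfRightInverse_comp_apply _ (Function.rightInverse_surjInv hq.surjective)
      ⟨P, fun t ht => (hqP t).1 ht⟩ t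
  have hspan : ∀ v ∈ Submodule.span ℝ (Set.range b), E v ∈ F.range := by
    intro v hv
    rw [← Fintype.range_linearCombination] at hv
    obtain ⟨t, rfl⟩ := hv
    exact ⟨q t, hFq t⟩
  have hΛspan : ∀ v ∈ Λ, v ∈ Submodule.span ℝ (Set.range b) := by
    intro v hv
    obtain ⟨k, rfl⟩ := (hbΛ v).1 hv
    exact Submodule.sum_mem _ fun i _ =>
      (Submodule.span ℝ (Set.range b)).toAddSubgroup.zsmul_mem
        (Submodule.subset_span (Set.mem_range_self i)) _
  refine ⟨m, F, ?_, ?_, ?_, fun v hv t => hspan _ (Submodule.smul_mem _ _ (hΛspan v hv)), ?_⟩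
  · rw [hq.isQuotientMap.continuous_iff]
    exact hP.congr fun t => (hFq t).symm
  · rw [injective_iff_map_eq_zero]
    intro a ha
    obtain ⟨t, rfl⟩ := hq.surjective a
    rw [hFq] at ha
    exact (hqP t).2 ha
  · rintro _ ⟨a, rfl⟩
    obtain ⟨t, rfl⟩ := hq.surjective a
    exact ⟨c t, (hFq t).symm⟩
  · intro K hK v hv
    apply hspan
    -- By compactness the part of `K` in the image is covered by the image of one ball. Hence each
    -- multiple `k • v` is within bounded distance of the kernel lattice; dividing by `k` exhibits
    -- `v` as a limit in the closed span of that lattice.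
    have hopen : IsOpen (E.range : Set G) := hEo.isOpen_range
    have hKE : IsCompact ((K : Set G) ∩ E.range) :=
      hK.inter_right (AddSubgroup.isClosed_of_isOpen _ hopen)
    obtain ⟨R, hR⟩ := hKE.elim_directed_cover (fun R : ℕ => E '' Metric.ball 0 R)
      (fun R => hEo _ Metric.isOpen_ball)
      (by
        rintro _ ⟨_, w, rfl⟩
        obtain ⟨R, hR⟩ := exists_nat_gt ‖w‖
        exact Set.mem_iUnion.2 ⟨R, w, mem_ball_zero_iff.2 hR, rfl⟩)
      (Monotone.directed_le fun R R' h =>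
        Set.image_mono (Metric.ball_subset_ball (Nat.cast_le.2 h)))
    have hx : ∀ k : ℕ, ∃ x, ‖x‖ < R ∧ (k : ℝ) • v - x ∈ Λ := by
      intro k
      have h1 : E ((k : ℝ) • v) ∈ (K : Set G) ∩ E.range := by
        refine ⟨?_, _, rfl⟩
        rw [Nat.cast_smul_eq_nsmul, map_nsmul]
        exact K.nsmul_mem hv k
      obtain ⟨x, hx, hxE⟩ := hR h1
      exact ⟨x, mem_ball_zero_iff.1 hx, by rw [hΛ, map_sub, hxE, sub_self]⟩
    choose x hxR hxΛ using hx
    have hlim : Tendsto (fun k : ℕ => v - (1 / ((k : ℝ) + 1)) • x (k + 1)) atTop (𝓝 v) := by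
      have h1 : Tendsto (fun k : ℕ => (1 / ((k : ℝ) + 1)) • x (k + 1)) atTop (𝓝 0) := by
        refine squeeze_zero_norm (a := fun k : ℕ => (1 / ((k : ℝ) + 1)) * R) (fun k => ?_) ?_
        · rw [norm_smul, Real.norm_of_nonneg (by positivity)]
          exact mul_le_mul_of_nonneg_left (hxR _).le (by positivity)
        · simpa using (tendsto_one_div_add_atTop_nhds_zero_nat (𝕜 := ℝ)).mul_const (R : ℝ)
      simpa using h1.const_sub v
    refine (Submodule.closed_of_finiteDimensional _).mem_of_tendsto hlim
      (Eventually.of_forall fun k => ?_)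
    have h1 := Submodule.smul_mem _ (1 / ((k : ℝ) + 1)) (hΛspan _ (hxΛ (k + 1)))
    have h2 : ((k : ℝ) + 1) ≠ 0 := by positivity
    push_cast at h1
    rwa [smul_sub, smul_smul, one_div_mul_cancel h2, one_smul] at h1

/-- A group without non-trivial compact subgroups and covered by a vector group has an open
subgroup which is a vector group. -/
theorem exponential_injective_of_forall_compact {n : ℕ} (E : (Fin n → ℝ) →+ G) (hE : Continuous E)
    (hEo : IsOpenMap E) (hEi : ∃ ε > 0, ∀ v, ‖v‖ < ε → E v = 0 → v = 0)
    (h : ∀ K : AddSubgroup G, IsCompact (K : Set G) → K = ⊥) : Function.Injective E := by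
  obtain ⟨m, F, hF, -, -, hker, -⟩ := exists_maximal_torus E hE hEo hEi
  obtain ⟨ε, hε, hEi⟩ := hEi
  have hbot : F.range = ⊥ := h _ (by
    rw [AddMonoidHom.coe_range]
    exact isCompact_range hF)
  rw [injective_iff_map_eq_zero]
  intro v hv
  -- The torus is compact, hence trivial, so the kernel is closed under real scaling; local
  -- injectivity applied to a short multiple of `v` finishes.
  have h1 : ∀ t : ℝ, E (t • v) = 0 := fun t => by simpa [hbot] using hker v hv t
  have h2 : ‖(ε / (2 * (‖v‖ + 1))) • v‖ < ε := by
    rw [norm_smul, Real.norm_of_nonneg (by positivity), div_mul_eq_mul_div,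
      div_lt_iff₀ (by positivity)]
    nlinarith [norm_nonneg v]
  have h3 := hEi _ h2 (h1 _)
  refine (smul_eq_zero.1 h3).resolve_left ?_
  positivity

end Torus

/-! ### Compact elements and compact generation -/

section CompactElements

variable (G : Type*) [AddCommGroup G] [TopologicalSpace G] [IsTopologicalAddGroup G]

/-- The subgroup of all elements that lie in a compact subgroup. -/
def compactElements : AddSubgroup G where
  carrier := {x | ∃ K : AddSubgroup G, IsCompact (K : Set G) ∧ x ∈ K}
  zero_mem' := ⟨⊥, by simp, zero_mem _⟩
  add_mem' := by
    rintro x y ⟨K, hK, hx⟩ ⟨K', hK', hy⟩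
    refine ⟨K ⊔ K', ?_, AddSubgroup.add_mem_sup hx hy⟩
    rw [AddSubgroup.add_normal]
    exact hK.add hK'
  neg_mem' := by
    rintro x ⟨K, hK, hx⟩
    exact ⟨K, hK, neg_mem hx⟩

variable {G}

theorem le_compactElements {K : AddSubgroup G} (hK : IsCompact (K : Set G)) :
    K ≤ compactElements G := fun _ hx => ⟨K, hK, hx⟩

theorem map_mem_compactElements {H : Type*} [AddCommGroup H] [TopologicalSpace H]
    [IsTopologicalAddGroup H] (f : G →+ H) (hf : Continuous f) {x : G}
    (hx : x ∈ compactElements G) : f x ∈ compactElements H := by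
  obtain ⟨K, hK, hx⟩ := hx
  refine ⟨K.map f, ?_, AddSubgroup.mem_map_of_mem f hx⟩
  rw [AddSubgroup.coe_map]
  exact hK.image hf

/-- The quotient by a compact subgroup is a proper map. -/
theorem isProperMap_quotientMk (N : AddSubgroup G) (hN : IsCompact (N : Set G)) :
    IsProperMap ((↑) : G → G ⧸ N) := by
  refine isProperMap_iff_isClosedMap_and_compact_fibers.2
    ⟨QuotientAddGroup.continuous_mk, QuotientAddGroup.isClosedMap_coe hN, fun y => ?_⟩
  obtain ⟨x, rfl⟩ := QuotientAddGroup.mk_surjective y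
  have : ((↑) : G → G ⧸ N) ⁻¹' {(x : G ⧸ N)} = (fun z => x + z) '' N := by
    ext z
    simp only [Set.mem_preimage, Set.mem_singleton_iff, Set.mem_image]
    rw [eq_comm, QuotientAddGroup.eq]
    exact ⟨fun h => ⟨_, h, by abel⟩, fun ⟨w, hw, h⟩ => by rw [← h]; simpa using hw⟩
  rw [this]
  exact hN.image (by fun_prop)

/-- The quotient map is proper, so compact subgroups pull back to compact subgroups. -/
theorem mem_compactElements_quotient_iff (N : AddSubgroup G) (hN : IsCompact (N : Set G)) {x : G} :
    (x : G ⧸ N) ∈ compactElements (G ⧸ N) ↔ x ∈ compactElements G := by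
  refine ⟨fun ⟨K, hK, hx⟩ => ⟨K.comap (QuotientAddGroup.mk' N), ?_, hx⟩,
    map_mem_compactElements (QuotientAddGroup.mk' N) QuotientAddGroup.continuous_mk⟩
  exact (isProperMap_quotientMk N hN).isCompact_preimage hK

theorem CompactlyGeneratedGroup.of_surjective {H : Type*} [AddCommGroup H] [TopologicalSpace H]
    (f : G →+ H) (hf : Continuous f) (hs : Function.Surjective f)
    (h : CompactlyGeneratedGroup G) : CompactlyGeneratedGroup H := by
  obtain ⟨C, hC, hneg, hgen⟩ := h
  refine ⟨f '' C, hC.image hf, ?_, fun y => ?_⟩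
  · rintro _ ⟨c, hc, rfl⟩
    exact ⟨-c, hneg c hc, map_neg f c⟩
  · obtain ⟨x, rfl⟩ := hs y
    obtain ⟨n, c, hc, rfl⟩ := hgen x
    exact ⟨n, fun i => f (c i), fun i => ⟨c i, hc i, rfl⟩, map_sum f _ _⟩

/-- A compactly generated discrete abelian group is finitely generated. -/
theorem CompactlyGeneratedGroup.module_finite {D : Type*} [AddCommGroup D] [TopologicalSpace D]
    [DiscreteTopology D] (h : CompactlyGeneratedGroup D) : Module.Finite ℤ D := by
  obtain ⟨C, hC, -, hgen⟩ := h
  refine ⟨Submodule.fg_def.2 ⟨C, isCompact_iff_finite.1 hC, ?_⟩⟩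
  rw [eq_top_iff]
  intro x _
  obtain ⟨n, c, hc, rfl⟩ := hgen x
  exact Submodule.sum_mem _ fun i _ => Submodule.subset_span (hc i)

/-- The compact elements of a compactly generated group covered by a vector group form a compact
subgroup. -/
theorem isCompact_compactElements_of_exponential {n : ℕ} (E : (Fin n → ℝ) →+ G)
    (hE : Continuous E) (hEo : IsOpenMap E) (hEi : ∃ ε > 0, ∀ v, ‖v‖ < ε → E v = 0 → v = 0)
    (hG : CompactlyGeneratedGroup G) : IsCompact (compactElements G : Set G) := by
  obtain ⟨m, F, hF, -, hFE, -, hFK⟩ := exists_maximal_torus E hE hEo hEi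
  have hFc : IsCompact (F.range : Set G) := by
    rw [AddMonoidHom.coe_range]
    exact isCompact_range hF
  have hopen : IsOpen (E.range : Set G) := hEo.isOpen_range
  have := QuotientAddGroup.discreteTopology hopen
  -- Compact elements become torsion in this finitely generated discrete quotient, so they meet only
  -- finitely many cosets of `E.range`, each of them in the empty set or a translate of the torus.
  have hfg : Module.Finite ℤ (G ⧸ E.range) :=
    (hG.of_surjective (QuotientAddGroup.mk' E.range) QuotientAddGroup.continuous_mk
      (QuotientAddGroup.mk'_surjective _)).module_finite
  have hfin : Finite (Submodule.torsion ℤ (G ⧸ E.range)) :=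
    Module.finite_of_fg_torsion _ Submodule.torsion_isTorsion
  have htors : ∀ x ∈ compactElements G, (x : G ⧸ E.range) ∈ Submodule.torsion ℤ (G ⧸ E.range) := by
    rintro x hx
    obtain ⟨K, hK, hxK⟩ :=
      map_mem_compactElements (QuotientAddGroup.mk' E.range) QuotientAddGroup.continuous_mk hx
    have hKf : Finite K := isCompact_iff_finite.1 hK
    have h1 := (isOfFinAddOrder_of_finite (⟨_, hxK⟩ : K))
    obtain ⟨k, hk, hk'⟩ := isOfFinAddOrder_iff_nsmul_eq_zero.1 h1
    rw [Submodule.mem_torsion_iff]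
    refine ⟨⟨k, mem_nonZeroDivisors_of_ne_zero (by exact_mod_cast hk.ne')⟩, ?_⟩
    have h2 := congrArg Subtype.val hk'
    simpa [Submonoid.smul_def] using h2
  have hunion : (compactElements G : Set G) =
      ⋃ d : Submodule.torsion ℤ (G ⧸ E.range),
        {x | x ∈ compactElements G ∧ (x : G ⧸ E.range) = d} := by
    ext x
    simp only [SetLike.mem_coe, Set.mem_iUnion, Set.mem_ofPred_eq]
    exact ⟨fun hx => ⟨⟨_, htors x hx⟩, hx, rfl⟩, fun ⟨_, hx, _⟩ => hx⟩
  rw [hunion]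
  refine isCompact_iUnion fun d => ?_
  rcases Set.eq_empty_or_nonempty {x | x ∈ compactElements G ∧ (x : G ⧸ E.range) = d} with h | h
  · rw [h]; exact isCompact_empty
  · obtain ⟨y, hy, hyd⟩ := h
    have h1 : {x | x ∈ compactElements G ∧ (x : G ⧸ E.range) = d} =
        (fun z => y + z) '' F.range := by
      ext x
      simp only [Set.mem_ofPred_eq, Set.mem_image, SetLike.mem_coe]
      constructor
      · rintro ⟨hx, hxd⟩
        obtain ⟨v, hv⟩ : -y + x ∈ E.range := QuotientAddGroup.eq.1 (hyd.trans hxd.symm)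
        obtain ⟨K, hK, hKx⟩ := add_mem (neg_mem hy) hx
        exact ⟨-y + x, hv ▸ hFK K hK v (hv ▸ hKx), by abel⟩
      · rintro ⟨z, hz, rfl⟩
        refine ⟨add_mem hy (le_compactElements hFc hz), ?_⟩
        rw [← hyd, eq_comm, QuotientAddGroup.eq]
        simpa using hFE hz
    rw [h1]
    exact hFc.image (by fun_prop)

/-- In a compactly generated locally compact abelian group the compact elements form a compact
subgroup. -/
theorem CompactlyGeneratedGroup.isCompact_compactElements [T2Space G] [LocallyCompactSpace G]
    (hG : CompactlyGeneratedGroup G) : IsCompact (compactElements G : Set G) := by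
  -- The size of `N` is irrelevant here: any compact `N` whose quotient has an exponential map will
  -- do.
  obtain ⟨N, hN, -, hchar⟩ := exists_compact_addSubgroup_quotient (G := G) univ_mem
  have : IsClosed (N : Set G) := hN.isClosed
  obtain ⟨n, E, hE, hEo, hEi⟩ := exists_exponential hchar
  have h1 := isCompact_compactElements_of_exponential E hE hEo hEi
    (hG.of_surjective (QuotientAddGroup.mk' N) QuotientAddGroup.continuous_mk
      (QuotientAddGroup.mk'_surjective _))
  have h2 : (compactElements G : Set G) = ((↑) : G → G ⧸ N) ⁻¹' compactElements (G ⧸ N) := by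
    ext x
    exact (mem_compactElements_quotient_iff N hN).symm
  rw [h2]
  exact (isProperMap_quotientMk N hN).isCompact_preimage h1

end CompactElements

/-! ### Splitting proper surjections onto vector groups -/

section Lifting

/-- A compact subgroup of a real normed space is trivial. -/
theorem eq_zero_of_mem_compact_addSubgroup {W : Type*} [NormedAddCommGroup W] [NormedSpace ℝ W]
    {K : AddSubgroup W} (hK : IsCompact (K : Set W)) {x : W} (hx : x ∈ K) : x = 0 := by
  obtain ⟨R, hR⟩ := hK.isBounded.exists_norm_le
  by_contra h
  have hx0 : 0 < ‖x‖ := norm_pos_iff.2 h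
  obtain ⟨k, hk⟩ := exists_nat_gt (R / ‖x‖)
  have h1 := hR _ (K.nsmul_mem hx k)
  rw [← Nat.cast_smul_eq_nsmul ℝ, norm_smul, Real.norm_of_nonneg (Nat.cast_nonneg k)] at h1
  rw [div_lt_iff₀ hx0] at hk
  linarith

variable {M : Type*} [AddCommGroup M] [TopologicalSpace M] [IsTopologicalAddGroup M]

/-- Among the closed subgroups that surject under a proper homomorphism there is a minimal one. -/
theorem exists_minimal_closed_surjecting {W : Type*} [AddCommGroup W] [TopologicalSpace W]
    [T1Space W] (π : M →+ W) (hπ : IsProperMap π) (hs : Function.Surjective π) :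
    ∃ H : AddSubgroup M, IsClosed (H : Set M) ∧ (∀ w, ∃ h ∈ H, π h = w) ∧
      ∀ H' : AddSubgroup M, IsClosed (H' : Set M) → (∀ w, ∃ h ∈ H', π h = w) → H' ≤ H → H ≤ H' := by
  -- Zorn's lemma for reverse inclusion: the intersection of a chain still surjects because the
  -- fibres of `π` are compact.
  let s : Set (AddSubgroup M)ᵒᵈ :=
    {H | IsClosed (H.ofDual : Set M) ∧ ∀ w, ∃ h ∈ H.ofDual, π h = w}
  obtain ⟨H, hH⟩ := zorn_le₀ s (fun c hcs hc => by
    rcases c.eq_empty_or_nonempty with rfl | hne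
    · exact ⟨OrderDual.toDual ⊤, ⟨isClosed_univ, fun w => ⟨(hs w).choose, trivial,
        (hs w).choose_spec⟩⟩, by simp⟩
    · have := hne.to_subtype
      refine ⟨OrderDual.toDual (⨅ H : c, H.1.ofDual), ⟨?_, fun w => ?_⟩, fun H hH => ?_⟩
      · simp only [OrderDual.ofDual_toDual, AddSubgroup.coe_iInf]
        exact isClosed_iInter fun H => (hcs H.2).1
      · obtain ⟨x, hx⟩ := IsCompact.nonempty_iInter_of_directed_nonempty_isCompact_isClosed
          (fun H : c => (H.1.ofDual : Set M) ∩ π ⁻¹' {w})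
          (fun H H' => by
            rcases hc.total H.2 H'.2 with h | h
            · exact ⟨H', Set.inter_subset_inter_left _ h, subset_rfl⟩
            · exact ⟨H, subset_rfl, Set.inter_subset_inter_left _ h⟩)
          (fun H => by
            obtain ⟨h, hh, hw⟩ := (hcs H.2).2 w
            exact ⟨h, hh, hw⟩)
          (fun H => (hπ.isCompact_preimage isCompact_singleton).inter_left (hcs H.2).1)
          (fun H => (hcs H.2).1.inter (isClosed_singleton.preimage hπ.continuous))
        rw [Set.mem_iInter] at hx
        refine ⟨x, ?_, (hx ⟨_, hne.some_mem⟩).2⟩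
        simp only [OrderDual.ofDual_toDual, AddSubgroup.mem_iInf]
        exact fun H => (hx H).1
      · exact iInf_le (fun H : c => H.1.ofDual) ⟨H, hH⟩)
  exact ⟨H.ofDual, hH.1.1, hH.1.2, fun H' h1 h2 h3 => hH.2 (y := OrderDual.toDual H') ⟨h1, h2⟩ h3⟩

/-- A proper surjection from a locally compact abelian group onto a vector group splits. -/
theorem exists_section_of_isProperMap [T2Space M] [LocallyCompactSpace M] {n : ℕ}
    (π : M →+ (Fin n → ℝ)) (hπ : IsProperMap π) (hs : Function.Surjective π) :
    ∃ σ : (Fin n → ℝ) →+ M, Continuous σ ∧ ∀ w, π (σ w) = w := by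
  obtain ⟨H, hHc, hHs, hmin⟩ := exists_minimal_closed_surjecting π hπ hs
  have hemb : IsClosedEmbedding (Subtype.val : H → M) := hHc.isClosedEmbedding_subtypeVal
  have : LocallyCompactSpace H := hHc.locallyCompactSpace
  let πH : H →+ (Fin n → ℝ) := π.comp H.subtype
  have hπH : IsProperMap πH := hπ.comp hemb.isProperMap
  have hπHs : Function.Surjective πH := fun w => by
    obtain ⟨h, hh, hw⟩ := hHs w
    exact ⟨⟨h, hh⟩, hw⟩
  -- For a non-zero `x` in the kernel, choose a compact `N` avoiding `x`. A section `σ` of `H ⧸ N →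
  -- ℝⁿ` exists by linear algebra, and the preimage of its image in `H` is a closed surjecting
  -- subgroup. Minimality makes it all of `H`, which forces `x ∈ N`.
  have hinj : Function.Injective πH := by
    rw [injective_iff_map_eq_zero]
    intro x hx
    by_contra hx0
    obtain ⟨N, hN, hNU, hchar⟩ := exists_compact_addSubgroup_quotient
      (isOpen_compl_singleton.mem_nhds (show (0 : H) ∈ ({x} : Set H)ᶜ from fun h => hx0 h.symm))
    have : IsClosed (N : Set H) := hN.isClosed
    obtain ⟨k, E, hE, hEo, -⟩ := exists_exponential hchar
    have hker : N ≤ πH.ker := fun y hy => by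
      refine eq_zero_of_mem_compact_addSubgroup (K := N.map πH) ?_ (AddSubgroup.mem_map_of_mem _ hy)
      rw [AddSubgroup.coe_map]
      exact hN.image hπH.continuous
    let πN : H ⧸ N →+ (Fin n → ℝ) := QuotientAddGroup.lift N πH hker
    have hπN : Continuous πN := continuous_quot_lift _ hπH.continuous
    have hopen : IsOpenMap πH :=
      (AddMonoidHom.isOpenQuotientMap_of_isQuotientMap
        (hπH.isClosedMap.isQuotientMap hπH.continuous hπHs)).isOpenMap
    have hπNo : IsOpenMap πN := fun U hU => by
      have h1 : πN '' U = πH '' (((↑) : H → H ⧸ N) ⁻¹' U) := by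
        rw [← Set.image_preimage_eq U (QuotientAddGroup.mk_surjective (s := N)), ← Set.image_comp]
        simp only [Set.image_preimage_eq U (QuotientAddGroup.mk_surjective (s := N))]
        rfl
      rw [h1]
      exact hopen _ (hU.preimage QuotientAddGroup.continuous_mk)
    -- Continuity makes the additive composite real linear, and openness makes it onto.
    let f : (Fin k → ℝ) →L[ℝ] (Fin n → ℝ) := (πN.comp E).toRealLinearMap (hπN.comp hE)
    have hfo : IsOpenMap f := hπNo.comp hEo
    have hfs : LinearMap.range f.toLinearMap = ⊤ := by
      refine Submodule.eq_top_of_nonempty_interior' _ ⟨0, ?_⟩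
      have h1 : IsOpen (LinearMap.range f.toLinearMap : Set (Fin n → ℝ)) := hfo.isOpen_range
      rw [h1.interior_eq]
      exact zero_mem _
    obtain ⟨g, hg⟩ := f.toLinearMap.exists_rightInverse_of_surjective hfs
    let σ : (Fin n → ℝ) →+ H ⧸ N := E.comp g.toAddMonoidHom
    have hσ : Continuous σ := hE.comp g.continuous_of_finiteDimensional
    have hπσ : ∀ w, πN (σ w) = w := fun w => LinearMap.congr_fun hg w
    let H' : AddSubgroup H := (QuotientAddGroup.mk' N).eqLocus (σ.comp πH)
    have hH' : IsClosed (H' : Set H) :=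
      isClosed_eq QuotientAddGroup.continuous_mk (hσ.comp hπH.continuous)
    have hle := hmin (H'.map H.subtype) (by
        rw [AddSubgroup.coe_map]
        exact hemb.isClosedMap _ hH')
      (fun w => by
        obtain ⟨h, hh⟩ := QuotientAddGroup.mk_surjective (σ w)
        have h1 : πH h = w := by
          rw [← hπσ w, ← hh]; rfl
        refine ⟨h, ⟨h, ?_, rfl⟩, h1⟩
        change (h : H ⧸ N) = σ (πH h)
        rw [h1, hh])
      (AddSubgroup.map_subtype_le H')
    obtain ⟨y, hy, hyx⟩ := hle x.2
    obtain rfl : y = x := Subtype.ext hyx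
    have h2 : (y : H ⧸ N) = σ (πH y) := hy
    rw [hx, map_zero, QuotientAddGroup.eq_zero_iff] at h2
    exact hNU h2 rfl
  let e : H ≃+ (Fin n → ℝ) := AddEquiv.ofBijective πH ⟨hinj, hπHs⟩
  have he : Continuous e.symm := by
    rw [continuous_iff_isClosed]
    intro s hs
    have : e.symm ⁻¹' s = πH '' s := (e.toEquiv.image_eq_preimage_symm s).symm
    rw [this]
    exact hπH.isClosedMap _ hs
  exact ⟨H.subtype.comp e.symm.toAddMonoidHom, continuous_subtype_val.comp he,
    fun w => e.apply_symm_apply w⟩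

end Lifting

/-! ### The regular trace form and its dual bases -/

section TraceForm

variable (A : Type*) [Ring A] [Algebra ℚ A]

/-- The bilinear form `(x, y) ↦ tr (z ↦ x y z)` of a finite-dimensional algebra. -/
noncomputable def regularTraceForm : LinearMap.BilinForm ℚ A :=
  (LinearMap.mul ℚ A).compr₂ (LinearMap.trace ℚ A ∘ₗ LinearMap.mul ℚ A)

variable {A}

theorem regularTraceForm_apply (x y : A) :
    regularTraceForm A x y = LinearMap.trace ℚ A (LinearMap.mul ℚ A (x * y)) := rfl

theorem regularTraceForm_mul_left (x y z : A) :
    regularTraceForm A (x * y) z = regularTraceForm A x (y * z) := by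
  rw [regularTraceForm_apply, regularTraceForm_apply, mul_assoc]

theorem regularTraceForm_comm (x y : A) : regularTraceForm A x y = regularTraceForm A y x := by
  have h : ∀ x y : A, LinearMap.mul ℚ A (x * y) = LinearMap.mul ℚ A x * LinearMap.mul ℚ A y := by
    intro x y
    ext z
    simp [mul_assoc]
  rw [regularTraceForm_apply, regularTraceForm_apply, h, h, LinearMap.trace_mul_comm]

/-- The radical is a left ideal, generated by an idempotent `e` by semisimplicity. Multiplication by
`e` is an idempotent operator of trace 0, hence zero in characteristic 0. -/
theorem eq_zero_of_regularTraceForm_eq_zero [Module.Finite ℚ A] [IsSemisimpleRing A] {x : A}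
    (hx : ∀ y, regularTraceForm A x y = 0) : x = 0 := by
  let I : Ideal A :=
    { carrier := {x | ∀ y, regularTraceForm A x y = 0}
      zero_mem' := fun y => by simp
      add_mem' := fun {a b} ha hb y => by
        rw [map_add, LinearMap.add_apply, ha y, hb y, add_zero]
      smul_mem' := fun c a ha y => by
        rw [smul_eq_mul, regularTraceForm_mul_left, regularTraceForm_comm,
          regularTraceForm_mul_left, ha] }
  obtain ⟨e, he, hI⟩ := IsSemisimpleRing.ideal_eq_span_idempotent I
  have heI : e ∈ I := by
    rw [hI]
    exact Ideal.mem_span_singleton_self e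
  have htr : LinearMap.trace ℚ A (LinearMap.mul ℚ A e) = 0 := by
    have := heI 1
    rwa [regularTraceForm_apply, mul_one] at this
  have hid : IsIdempotentElem (LinearMap.mul ℚ A e) := by
    ext z
    simp only [Module.End.mul_apply, LinearMap.mul_apply']
    rw [← mul_assoc, he.eq]
  have h0 := LinearMap.IsIdempotentElem.eq_zero_of_trace_eq_zero hid htr
  have he0 : e = 0 := by simpa using LinearMap.congr_fun h0 1
  have hxI : x ∈ I := hx
  rw [hI, he0] at hxI
  simpa using hxI

theorem regularTraceForm_nondegenerate [Module.Finite ℚ A] [IsSemisimpleRing A] :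
    (regularTraceForm A).Nondegenerate :=
  ⟨fun _ hx => eq_zero_of_regularTraceForm_eq_zero hx, fun _ hx =>
    eq_zero_of_regularTraceForm_eq_zero fun y => by rw [regularTraceForm_comm, hx]⟩

section DualBasis

variable [Module.Finite ℚ A] [IsSemisimpleRing A] {m : ℕ} (B : Module.Basis (Fin m) ℚ A)

/-- The basis dual to `B` with respect to the regular trace form. -/
noncomputable def traceDual (i : Fin m) : A :=
  (regularTraceForm A).dualBasis regularTraceForm_nondegenerate B i

theorem regularTraceForm_traceDual (i : Fin m) (v : A) :
    regularTraceForm A (traceDual B i) v = B.repr v i := by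
  conv_lhs => rw [← B.sum_repr v]
  simp only [map_sum, map_smul, traceDual, LinearMap.BilinForm.apply_dualBasis_left, smul_eq_mul,
    mul_ite, mul_one, mul_zero, Finset.sum_ite_eq', Finset.mem_univ, if_true]

/-- By invariance of the form, right multiplication on the dual basis has the same structure
constants as left multiplication on `B`. This is the Casimir property. -/
theorem traceDual_mul (j : Fin m) (x : A) :
    traceDual B j * x = ∑ i, B.repr (x * B i) j • traceDual B i := by
  rw [← sub_eq_zero]
  refine eq_zero_of_regularTraceForm_eq_zero fun y => ?_
  have h : ∀ k, regularTraceForm A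
      (traceDual B j * x - ∑ i, B.repr (x * B i) j • traceDual B i) (B k) = 0 := by
    intro k
    simp only [map_sub, LinearMap.sub_apply, map_sum, LinearMap.sum_apply, map_smul,
      LinearMap.smul_apply, regularTraceForm_mul_left, regularTraceForm_traceDual]
    simp [Finsupp.single_apply]
  have h2 : regularTraceForm A
      (traceDual B j * x - ∑ i, B.repr (x * B i) j • traceDual B i) = 0 := B.ext h
  rw [h2, LinearMap.zero_apply]

/-- Paired with `y`, the sum gives the trace of left multiplication by `y`, which is also the
pairing of `y` with 1. Using the regular trace is what makes the value exactly 1. -/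
theorem sum_basis_mul_traceDual : ∑ i, B i * traceDual B i = 1 := by
  rw [← sub_eq_zero]
  refine eq_zero_of_regularTraceForm_eq_zero fun y => ?_
  rw [regularTraceForm_comm, map_sub, map_sum, sub_eq_zero, regularTraceForm_apply y 1, mul_one,
    LinearMap.trace_eq_matrix_trace ℚ B, Matrix.trace]
  refine Finset.sum_congr rfl fun i _ => ?_
  rw [← regularTraceForm_mul_left, regularTraceForm_comm, regularTraceForm_traceDual,
    Matrix.diag_apply, LinearMap.toMatrix_apply, LinearMap.mul_apply']

end DualBasis

end TraceForm

/-- The properties of a hereditary order in a semisimple algebra that matter for its modules.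
The elements `a i` and `b i` form a Casimir element. -/
structure IsHereditaryOrder (S : Type*) [Ring S] : Prop where
  projective : ∀ I : Submodule S S, Module.Projective S I
  exists_almost_unit : ∀ I : Submodule S S, ∃ z ∈ I, ∃ k : ℕ, k ≠ 0 ∧ ∀ x ∈ I, x * z = k • x
  exists_casimir : ∃ (m : ℕ) (a b : Fin m → S) (N : ℕ), N ≠ 0 ∧ ∑ i, a i * b i = N ∧
    ∀ x, ∃ c : Fin m → Fin m → ℤ, (∀ i, x * a i = ∑ j, c i j • a j) ∧
      ∀ j, b j * x = ∑ i, c i j • b i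

/-! ### From the semisimple algebra to the order: clearing denominators -/

section Orders

variable {A : Type*} [Ring A] [Algebra ℚ A] {S : Type*} [Ring S]
  (ι : S →+* A)

/-- The left ideal of `A` generated by `I` has an idempotent generator, which is a right identity on
it; `z` is a multiple of this idempotent lying in `I`. -/
theorem exists_almost_unit_of_order [IsSemisimpleRing A] (hι : Function.Injective ι)
    (hden : ∀ a : A, ∃ (k : ℕ) (s : S), k ≠ 0 ∧ k • a = ι s) (I : Submodule S S) :
    ∃ z ∈ I, ∃ k : ℕ, k ≠ 0 ∧ ∀ x ∈ I, x * z = k • x := by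
  let J : Ideal A := Ideal.span (ι '' I)
  have hJ : ∀ a ∈ J, ∃ (k : ℕ) (x : S), k ≠ 0 ∧ x ∈ I ∧ k • a = ι x := by
    intro a ha
    induction ha using Submodule.span_induction with
    | mem a ha =>
      obtain ⟨x, hx, rfl⟩ := ha
      exact ⟨1, x, one_ne_zero, hx, one_smul _ _⟩
    | zero => exact ⟨1, 0, one_ne_zero, zero_mem _, by simp⟩
    | add a b _ _ iha ihb =>
      obtain ⟨k, x, hk, hx, hkx⟩ := iha
      obtain ⟨l, y, hl, hy, hly⟩ := ihb
      refine ⟨k * l, l • x + k • y, mul_ne_zero hk hl,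
        add_mem (nsmul_mem hx l) (nsmul_mem hy k), ?_⟩
      rw [map_add, map_nsmul, map_nsmul, ← hkx, ← hly, smul_add, smul_smul, smul_smul, mul_comm l]
    | smul r a _ iha =>
      obtain ⟨k, x, hk, hx, hkx⟩ := iha
      obtain ⟨l, s, hl, hls⟩ := hden r
      refine ⟨l * k, s * x, mul_ne_zero hl hk, I.smul_mem s hx, ?_⟩
      rw [map_mul, ← hkx, ← hls, smul_eq_mul, smul_mul_smul_comm]
  obtain ⟨e, he, hJe⟩ := IsSemisimpleRing.ideal_eq_span_idempotent J
  obtain ⟨k, z, hk, hz, hkz⟩ := hJ e (by rw [hJe]; exact Ideal.mem_span_singleton_self e)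
  refine ⟨z, hz, k, hk, fun x hx => hι ?_⟩
  have hxJ : ι x ∈ J := Ideal.subset_span ⟨x, hx, rfl⟩
  rw [hJe] at hxJ
  obtain ⟨r, hr⟩ := Ideal.mem_span_singleton'.1 hxJ
  rw [map_mul, map_nsmul, ← hkz, mul_smul_comm, ← hr, mul_assoc, he.eq]

/-- A ℤ-basis of the order has integral structure constants, and a common multiple `N` of the
denominators brings its trace-dual basis into the order. -/
theorem exists_casimir_of_order [Module.Finite ℚ A] [IsSemisimpleRing A] [Module.Finite ℤ S]
    (hι : Function.Injective ι)
    (hden : ∀ a : A, ∃ (k : ℕ) (s : S), k ≠ 0 ∧ k • a = ι s) :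
    ∃ (m : ℕ) (a b : Fin m → S) (N : ℕ), N ≠ 0 ∧ ∑ i, a i * b i = N ∧
      ∀ x, ∃ c : Fin m → Fin m → ℤ, (∀ i, x * a i = ∑ j, c i j • a j) ∧
        ∀ j, b j * x = ∑ i, c i j • b i := by
  have htfA : IsAddTorsionFree A := .of_module_rat _
  have htf : IsAddTorsionFree S := Function.Injective.isAddTorsionFree (ι : S →+ A) hι
  let b := Module.finBasis ℤ S
  let m := Module.finrank ℤ S
  have hli : LinearIndependent ℚ (fun i => ι (b i)) := by
    rw [← LinearIndependent.iff_fractionRing ℤ ℚ]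
    exact b.linearIndependent.map' ι.toAddMonoidHom.toIntLinearMap
      (LinearMap.ker_eq_bot.2 hι)
  have hsp : ⊤ ≤ Submodule.span ℚ (Set.range fun i => ι (b i)) := by
    intro a _
    obtain ⟨k, s, hk, hks⟩ := hden a
    have hk' : (k : ℚ) ≠ 0 := Nat.cast_ne_zero.2 hk
    have h1 : a = (k : ℚ)⁻¹ • ι s := by
      rw [← hks, ← Nat.cast_smul_eq_nsmul ℚ, smul_smul, inv_mul_cancel₀ hk', one_smul]
    rw [h1]
    refine Submodule.smul_mem _ _ ?_
    rw [← b.sum_repr s, map_sum]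
    refine Submodule.sum_mem _ fun i _ => ?_
    rw [map_zsmul]
    exact (Submodule.span ℚ (Set.range fun i => ι (b i))).toAddSubgroup.zsmul_mem
      (Submodule.subset_span (Set.mem_range_self i)) _
  let B : Module.Basis (Fin m) ℚ A := Module.Basis.mk hli hsp
  have hB : ∀ i, B i = ι (b i) := fun i => by simp [B]
  have hrepr : ∀ s i, B.repr (ι s) i = (b.repr s i : ℚ) := by
    intro s i
    have h1 : ι s = ∑ j, (b.repr s j : ℚ) • B j := by
      conv_lhs => rw [← b.sum_repr s]
      simp only [map_sum, map_zsmul, hB, Int.cast_smul_eq_zsmul]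
    rw [h1, B.repr_sum_self]
  choose k s hk hks using fun i => hden (traceDual B i)
  let N := ∏ i, k i
  have hN : N ≠ 0 := Finset.prod_ne_zero_iff.2 fun i _ => hk i
  let β : Fin m → S := fun i => (∏ j ∈ Finset.univ.erase i, k j) • s i
  have hβ : ∀ i, ι (β i) = N • traceDual B i := fun i => by
    simp only [β, map_nsmul, ← hks, smul_smul]
    rw [Finset.prod_erase_mul _ _ (Finset.mem_univ i)]
  refine ⟨m, b, β, N, hN, hι ?_, fun x => ⟨fun i j => b.repr (x * b i) j, fun i => ?_, fun j => ?_⟩⟩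
  · simp only [map_sum, map_mul, hβ, mul_smul_comm, ← hB, map_natCast]
    rw [← Finset.smul_sum, sum_basis_mul_traceDual, nsmul_eq_mul, mul_one]
  · exact (b.sum_repr _).symm
  · apply hι
    rw [map_mul, hβ, smul_mul_assoc, traceDual_mul, map_sum, Finset.smul_sum]
    refine Finset.sum_congr rfl fun i _ => ?_
    rw [hB, ← map_mul, hrepr, map_zsmul, hβ, Int.cast_smul_eq_zsmul, smul_comm]

end Orders

/-! ### Averaging, projective lattices and injective divisible modules -/

section OrderModules

variable {S : Type*} [Ring S]

/-- Averaging an additive map over a Casimir element yields a linear map. -/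
def casimirAverage {m : ℕ} (a b : Fin m → S)
    (hab : ∀ x, ∃ c : Fin m → Fin m → ℤ, (∀ i, x * a i = ∑ j, c i j • a j) ∧
      ∀ j, b j * x = ∑ i, c i j • b i)
    {W M : Type*} [AddCommGroup W] [Module S W] [AddCommGroup M] [Module S M] (φ : W →+ M) :
    W →ₗ[S] M where
  toFun w := ∑ i, a i • φ (b i • w)
  map_add' v w := by simp only [smul_add, map_add, Finset.sum_add_distrib]
  map_smul' x w := by
    -- The same integers `c i j` describe `x` acting on both families, and they pass through the
    -- additive map `φ`.
    obtain ⟨c, hca, hcb⟩ := hab x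
    simp only [RingHom.id_apply, smul_smul, Finset.smul_sum, hca, hcb, Finset.sum_smul, map_sum,
      smul_assoc, map_zsmul]
    rw [Finset.sum_comm]
    refine Finset.sum_congr rfl fun i _ => Finset.sum_congr rfl fun j _ => ?_
    rw [smul_comm]

/-- A proper surjection of locally compact modules over a hereditary order onto a vector module
splits. -/
theorem IsHereditaryOrder.exists_section_of_isProperMap (hS : IsHereditaryOrder S)
    {W M : Type*} [AddCommGroup W] [Module S W] [TopologicalSpace W] [IsTopologicalAddGroup W]
    [ContinuousConstSMul S W] [AddCommGroup M] [Module S M] [TopologicalSpace M]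
    [IsTopologicalAddGroup M] [T2Space M] [LocallyCompactSpace M] [ContinuousConstSMul S M]
    (hW : IsVectorGroup W) (π : M →L[S] W) (hπ : IsProperMap π) (hs : Function.Surjective π) :
    ∃ σ : W →L[S] M, Function.RightInverse σ π := by
  obtain ⟨n, ⟨e⟩⟩ := hW
  obtain ⟨m, a, b, N, hN, hsum, hab⟩ := hS.exists_casimir
  have hN' : (N : ℝ) ≠ 0 := Nat.cast_ne_zero.2 hN
  obtain ⟨s, hs, hπs⟩ := LCAModule.exists_section_of_isProperMap
    ((e : W →+ (Fin n → ℝ)).comp (π : M →+ W)) (e.toHomeomorph.isProperMap.comp hπ)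
    (e.surjective.comp hs)
  -- Dividing by `N` beforehand compensates for `∑ a i * b i = N` in the average.
  let d : (Fin n → ℝ) →+ (Fin n → ℝ) := DistribSMul.toAddMonoidHom _ (N : ℝ)⁻¹
  have hd : Continuous d := continuous_const_smul _
  let φ : W →+ M := (s.comp d).comp (e : W →+ (Fin n → ℝ))
  have hφ : Continuous φ := (hs.comp hd).comp e.continuous
  have hπφ : ∀ w, π (φ (N • w)) = w := by
    intro w
    apply e.injective
    have h1 : e (π (φ (N • w))) = d (e (N • w)) := hπs _
    rw [h1, map_nsmul, ← Nat.cast_smul_eq_nsmul ℝ]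
    exact inv_smul_smul₀ hN' _
  have hdiv : ∀ w : W, ∃ v, w = N • v := by
    intro w
    refine ⟨e.symm ((N : ℝ)⁻¹ • e w), ?_⟩
    rw [← map_nsmul, ← Nat.cast_smul_eq_nsmul ℝ, smul_inv_smul₀ hN']
    exact (e.symm_apply_apply w).symm
  refine ⟨⟨casimirAverage a b hab φ, ?_⟩, fun w => ?_⟩
  · change Continuous fun w => ∑ i, a i • φ (b i • w)
    fun_prop
  · obtain ⟨v, rfl⟩ := hdiv w
    change π (∑ i, a i • φ (b i • (N • v))) = N • v
    simp only [map_sum, map_smul, smul_comm (_ : S) N v, hπφ, smul_smul]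
    rw [← Finset.sum_smul, hsum, Nat.cast_smul_eq_nsmul]

/-- Over a ring all of whose left ideals are projective, submodules of finitely generated free
modules are projective. -/
theorem projective_of_injective_to_pi (h : ∀ I : Submodule S S, Module.Projective S I) (k : ℕ) :
    ∀ {P : Type*} [AddCommGroup P] [Module S P] (f : P →ₗ[S] (Fin k → S)),
      Function.Injective f → Module.Projective S P := by
  induction k with
  | zero =>
    intro P _ _ f hf
    have : Subsingleton P := hf.subsingleton
    infer_instance
  | succ k ih =>
    intro P _ _ f hf
    -- The image of one coordinate is a left ideal, hence projective, so `P` is the sum of it and of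
    -- a kernel embedded in one coordinate fewer.
    let g : P →ₗ[S] S := LinearMap.proj 0 ∘ₗ f
    have hI : Module.Projective S (LinearMap.range g) := h _
    obtain ⟨s, hs⟩ := Module.projective_lifting_property g.rangeRestrict LinearMap.id
      g.surjective_rangeRestrict
    have hs' : ∀ y, g (s y) = y := fun y => congrArg Subtype.val (LinearMap.congr_fun hs y)
    have hK : Module.Projective S (LinearMap.ker g) := by
      refine ih (LinearMap.funLeft S S Fin.succ ∘ₗ f ∘ₗ (LinearMap.ker g).subtype) ?_
      rw [← LinearMap.ker_eq_bot, LinearMap.ker_eq_bot']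
      intro x hx
      refine Subtype.ext (hf ?_)
      rw [Submodule.coe_zero, map_zero]
      ext i
      refine Fin.cases ?_ (fun i => ?_) i
      · exact x.2
      · exact congrFun hx i
    let p : P →ₗ[S] LinearMap.ker g :=
      LinearMap.codRestrict _ (LinearMap.id - s ∘ₗ g.rangeRestrict) fun x => by
        simp [hs']
    refine Module.Projective.of_split (p.prod g.rangeRestrict)
      ((LinearMap.ker g).subtype.coprod s) ?_
    ext x
    simp [p]

/-- Lattices over a hereditary order are projective. -/
theorem IsHereditaryOrder.projective_of_lattice (hS : IsHereditaryOrder S) (Γ : Type*)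
    [AddCommGroup Γ] [Module S Γ] [Module.Finite ℤ Γ] [Module.Free ℤ Γ] :
    Module.Projective S Γ := by
  obtain ⟨m, a, b, N, hN, hsum, hab⟩ := hS.exists_casimir
  let e := Module.finBasis ℤ Γ
  -- The averaged coordinate functions satisfy `∑ f γ j • e j = N • γ`, which gives injectivity
  -- because `Γ` is torsion-free.
  let f : Γ →ₗ[S] (Fin (Module.finrank ℤ Γ) → S) := LinearMap.pi fun j =>
    casimirAverage a b hab
      ((zmultiplesHom S 1).comp (e.coord j).toAddMonoidHom : Γ →+ S)
  have hf : ∀ γ j, f γ j = ∑ i, a i * ((e.repr (b i • γ) j : ℤ) : S) := by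
    intro γ j
    change ∑ i, a i • ((e.repr (b i • γ) j) • (1 : S)) = _
    simp [zsmul_eq_mul]
  refine projective_of_injective_to_pi hS.projective _ f ?_
  rw [injective_iff_map_eq_zero]
  intro γ hγ
  have h1 : ∑ j, f γ j • e j = N • γ := by
    simp only [hf, Finset.sum_smul, mul_smul, Int.cast_smul_eq_zsmul]
    rw [Finset.sum_comm]
    simp only [← Finset.smul_sum, e.sum_repr, smul_smul]
    rw [← Finset.sum_smul, hsum, Nat.cast_smul_eq_nsmul]
  rw [hγ] at h1
  simp only [Pi.zero_apply, zero_smul, Finset.sum_const_zero] at h1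
  have h2 : (N : ℤ) • γ = 0 := by rw [natCast_zsmul, ← h1]
  exact (smul_eq_zero.1 h2).resolve_left (by exact_mod_cast hN)

/-- Over a hereditary order divisible modules are injective. -/
theorem IsHereditaryOrder.baer_of_divisible (hS : IsHereditaryOrder S) (M : Type*)
    [AddCommGroup M] [Module S M] (hM : ∀ x : M, ∃ h : ℚ →+ M, h 1 = x) : Module.Baer S M := by
  intro I f
  let ev : (ℚ →+ M) →ₗ[S] M :=
    { toFun := fun h => h 1
      map_add' := fun _ _ => rfl
      map_smul' := fun _ _ => rfl }
  have := hS.projective I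
  obtain ⟨F, hF⟩ := Module.projective_lifting_property ev f hM
  obtain ⟨z, hz, k, hk, hzk⟩ := hS.exists_almost_unit I
  have hk' : (k : ℚ) ≠ 0 := Nat.cast_ne_zero.2 hk
  let ev' : (ℚ →+ M) →ₗ[S] M :=
    { toFun := fun h => h (k : ℚ)⁻¹
      map_add' := fun _ _ => rfl
      map_smul' := fun _ _ => rfl }
  let μ : S →ₗ[S] I := LinearMap.codRestrict I (LinearMap.toSpanSingleton S S z)
    fun r => I.smul_mem r hz
  -- The extension sends `r` to `F (r z)` evaluated at `1/k`. For `x ∈ I` one has `x z = k x`, so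
  -- the value is `F x` at 1, that is, `f x`.
  refine ⟨ev' ∘ₗ F ∘ₗ μ, fun x hx => ?_⟩
  have h1 : μ x = k • (⟨x, hx⟩ : I) := Subtype.ext (hzk x hx)
  have h2 : F ⟨x, hx⟩ 1 = f ⟨x, hx⟩ := LinearMap.congr_fun hF ⟨x, hx⟩
  change F (μ x) (k : ℚ)⁻¹ = _
  rw [h1, map_nsmul, AddMonoidHom.nsmul_apply, ← map_nsmul, nsmul_eq_mul, mul_inv_cancel₀ hk', h2]

end OrderModules

section SubringOrders

variable {A : Type*} [Ring A] [Algebra ℚ A]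

theorem IsZOrder.exists_nsmul_mem {𝔄 : Subring A} (h : IsZOrder 𝔄) (a : A) :
    ∃ (k : ℕ) (s : 𝔄), k ≠ 0 ∧ k • a = s := by
  have ha : a ∈ Submodule.span ℚ (𝔄 : Set A) := h.span_eq_top ▸ Submodule.mem_top
  induction ha using Submodule.span_induction with
  | mem a ha => exact ⟨1, ⟨a, ha⟩, one_ne_zero, one_smul _ _⟩
  | zero => exact ⟨1, 0, one_ne_zero, by simp⟩
  | add a b _ _ iha ihb =>
    obtain ⟨k, x, hk, hkx⟩ := iha
    obtain ⟨l, y, hl, hly⟩ := ihb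
    refine ⟨k * l, l • x + k • y, mul_ne_zero hk hl, ?_⟩
    push_cast
    rw [← hkx, ← hly, smul_add, smul_smul, smul_smul, mul_comm l]
  | smul q a _ iha =>
    obtain ⟨k, x, hk, hkx⟩ := iha
    refine ⟨q.den * k, q.num • x, mul_ne_zero q.den_nz hk, ?_⟩
    push_cast
    rw [← hkx, mul_smul, smul_comm k q a, ← Nat.cast_smul_eq_nsmul ℚ q.den, smul_smul,
      Rat.den_mul_eq_num, Int.cast_smul_eq_zsmul]

theorem IsZOrder.isHereditaryOrder [Module.Finite ℚ A] [IsSemisimpleRing A] {𝔄 : Subring A}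
    (h : IsZOrder 𝔄) (h' : IsHereditaryRing 𝔄) : IsHereditaryOrder 𝔄 := by
  have := h.finite
  exact
    { projective := h'.left
      exists_almost_unit := exists_almost_unit_of_order 𝔄.subtype Subtype.val_injective
        h.exists_nsmul_mem
      exists_casimir := exists_casimir_of_order 𝔄.subtype Subtype.val_injective
        h.exists_nsmul_mem }

theorem IsZOrder.isHereditaryOrder_mulOpposite [Module.Finite ℚ A] [IsSemisimpleRing A]
    {𝔄 : Subring A} (h : IsZOrder 𝔄) (h' : IsHereditaryRing 𝔄) : IsHereditaryOrder 𝔄ᵐᵒᵖ := by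
  have := h.finite
  have : Module.Finite ℤ 𝔄ᵐᵒᵖ := Module.Finite.equiv (MulOpposite.opLinearEquiv ℤ)
  have : Module.Finite ℚ Aᵐᵒᵖ := Module.Finite.equiv (MulOpposite.opLinearEquiv ℚ)
  have hinj : Function.Injective 𝔄.subtype.op := fun x y hxy =>
    MulOpposite.unop_injective (Subtype.ext (congrArg MulOpposite.unop hxy))
  have hden : ∀ a : Aᵐᵒᵖ, ∃ (k : ℕ) (s : 𝔄ᵐᵒᵖ), k ≠ 0 ∧ k • a = 𝔄.subtype.op s := fun a => by
    obtain ⟨k, s, hk, hks⟩ := h.exists_nsmul_mem a.unop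
    exact ⟨k, .op s, hk, MulOpposite.unop_injective hks⟩
  refine
    { projective := fun I => ?_
      exists_almost_unit := exists_almost_unit_of_order _ hinj hden
      exists_casimir := exists_casimir_of_order _ hinj hden }
  -- Left ideals of the opposite ring correspond to right ideals of `𝔄`, so the right-hand half of
  -- heredity applies.
  let e : 𝔄 ≃ₗ[𝔄ᵐᵒᵖ] 𝔄ᵐᵒᵖ :=
    { MulOpposite.opAddEquiv with
      map_smul' := fun _ _ => rfl }
  have := h'.right (I.comap e.toLinearMap)
  exact Module.Projective.of_equiv (e.submoduleMap (I.comap e.toLinearMap) ≪≫ₗ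
    LinearEquiv.ofEq _ _ (Submodule.map_comap_eq_of_surjective e.surjective I))

end SubringOrders

/-! ### Topological modules: internal sums, quotients, canonical submodules -/

section TopologicalModules

variable {S : Type*} [Ring S] {M : Type*} [AddCommGroup M] [Module S M] [TopologicalSpace M]

/-- The range of a continuous linear map with a continuous left inverse. -/
def equivRangeOfLeftInverse {X : Type*} [AddCommGroup X] [Module S X] [TopologicalSpace X]
    (i : X →L[S] M) (p : M →L[S] X) (h : Function.LeftInverse p i) :
    LinearMap.range i.toLinearMap ≃L[S] X where
  toLinearEquiv := (LinearEquiv.ofLeftInverse (f := i.toLinearMap) h).symm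
  continuous_toFun := p.continuous.comp continuous_subtype_val
  continuous_invFun := i.continuous.subtype_mk _

theorem equivRangeOfLeftInverse_apply {X : Type*} [AddCommGroup X] [Module S X]
    [TopologicalSpace X] (i : X →L[S] M) (p : M →L[S] X) (h : Function.LeftInverse p i)
    (y : LinearMap.range i.toLinearMap) : i (equivRangeOfLeftInverse i p h y) = y := by
  obtain ⟨_, x, rfl⟩ := y
  exact congrArg i (h x)

/-- A topological isomorphism with a product of three modules induces an internal direct sum
decomposition. -/
theorem exists_isTopDirectSum_of_equiv {X Y Z : Type*} [AddCommGroup X] [Module S X]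
    [TopologicalSpace X] [AddCommGroup Y] [Module S Y] [TopologicalSpace Y] [AddCommGroup Z]
    [Module S Z] [TopologicalSpace Z] (e : (X × Y × Z) ≃L[S] M) :
    ∃ X' Y' Z' : Submodule S M, Nonempty (X' ≃L[S] X) ∧ Nonempty (Y' ≃L[S] Y) ∧
      Nonempty (Z' ≃L[S] Z) ∧ IsTopDirectSum X' Y' Z' := by
  let e' : (X × Y × Z) →L[S] M := e
  let d : M →L[S] (X × Y × Z) := e.symm
  let iX := e'.comp (.inl S X (Y × Z))
  let iY := e'.comp ((ContinuousLinearMap.inr S X (Y × Z)).comp (.inl S Y Z))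
  let iZ := e'.comp ((ContinuousLinearMap.inr S X (Y × Z)).comp (.inr S Y Z))
  have hX : Function.LeftInverse ((ContinuousLinearMap.fst S X (Y × Z)).comp d) iX := fun x => by
    simp [iX, e', d]
  have hY : Function.LeftInverse ((ContinuousLinearMap.fst S Y Z).comp
      ((ContinuousLinearMap.snd S X (Y × Z)).comp d)) iY := fun x => by
    simp [iY, e', d]
  have hZ : Function.LeftInverse ((ContinuousLinearMap.snd S Y Z).comp
      ((ContinuousLinearMap.snd S X (Y × Z)).comp d)) iZ := fun x => by
    simp [iZ, e', d]
  refine ⟨_, _, _, ⟨equivRangeOfLeftInverse iX _ hX⟩, ⟨equivRangeOfLeftInverse iY _ hY⟩,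
    ⟨equivRangeOfLeftInverse iZ _ hZ⟩,
    ((equivRangeOfLeftInverse iX _ hX).prodCongr ((equivRangeOfLeftInverse iY _ hY).prodCongr
      (equivRangeOfLeftInverse iZ _ hZ))).trans e, fun p => ?_⟩
  conv_rhs => rw [← equivRangeOfLeftInverse_apply iX _ hX p.1,
    ← equivRangeOfLeftInverse_apply iY _ hY p.2.1, ← equivRangeOfLeftInverse_apply iZ _ hZ p.2.2]
  change e (_, _, _) = e (_, _) + e (_, _) + e (_, _)
  rw [← map_add, ← map_add]
  simp

/-- The underlying isomorphism of topological groups. -/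
def continuousAddEquivOfLinear {X Y : Type*} [AddCommGroup X] [Module S X]
    [TopologicalSpace X] [AddCommGroup Y] [Module S Y] [TopologicalSpace Y] (e : X ≃L[S] Y) :
    X ≃ₜ+ Y where
  toAddEquiv := e.toAddEquiv
  continuous_toFun := e.continuous
  continuous_invFun := e.symm.continuous

instance continuousConstSMul_submodule [ContinuousConstSMul S M] (N : Submodule S M) :
    ContinuousConstSMul S N where
  continuous_const_smul r := (continuous_subtype_val.const_smul r).subtype_mk _

instance continuousConstSMul_quotient [IsTopologicalAddGroup M] [ContinuousConstSMul S M]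
    (K : Submodule S M) : ContinuousConstSMul S (M ⧸ K) where
  continuous_const_smul r := by
    rw [K.isQuotientMap_mkQ.continuous_iff]
    exact K.continuous_mkQ.comp (continuous_const_smul r)

theorem locallyCompactSpace_quotient [IsTopologicalAddGroup M] [LocallyCompactSpace M]
    (K : Submodule S M) : LocallyCompactSpace (M ⧸ K) :=
  K.isOpenQuotientMap_mkQ.locallyCompactSpace

theorem isProperMap_mkQ [IsTopologicalAddGroup M] (K : Submodule S M)
    (hK : IsCompact (K : Set M)) : IsProperMap K.mkQ :=
  isProperMap_quotientMk K.toAddSubgroup hK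

/-- The submodule of all elements that lie in a compact subgroup. -/
def compactSubmodule (S M : Type*) [Ring S] [AddCommGroup M] [Module S M] [TopologicalSpace M]
    [IsTopologicalAddGroup M] [ContinuousConstSMul S M] : Submodule S M :=
  { compactElements M with
    smul_mem' := fun r _ hx =>
      map_mem_compactElements (DistribSMul.toAddMonoidHom M r) (continuous_const_smul r) hx }

/-- The image of an open continuous homomorphism from a vector group, as a submodule. -/
def exponentialSubmodule (S : Type*) [Ring S] {M : Type*} [AddCommGroup M] [Module S M]
    [TopologicalSpace M] [IsTopologicalAddGroup M] [ContinuousConstSMul S M] {n : ℕ}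
    (E : (Fin n → ℝ) →+ M) (hE : Continuous E) (hEo : IsOpenMap E) : Submodule S M :=
  { E.range with
    smul_mem' := by
      rintro r _ ⟨v, rfl⟩
      have hopen : IsOpen (E.range : Set M) := hEo.isOpen_range
      -- The image of ℝⁿ under `r • E` is connected and contains 0, while the open subgroup
      -- `E.range` is also closed.
      have hsub : Set.range (fun v => r • E v) ⊆ E.range :=
        (isPreconnected_range (hE.const_smul r)).subset_isClopen
          ⟨AddSubgroup.isClosed_of_isOpen _ hopen, hopen⟩
          ⟨0, ⟨0, by simp⟩, zero_mem _⟩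
      exact hsub ⟨v, rfl⟩ }

end TopologicalModules

section Groups

variable {G : Type*} [AddCommGroup G] [TopologicalSpace G] [IsTopologicalAddGroup G]

theorem isVectorGroup_of_bijective {n : ℕ} (E : (Fin n → ℝ) →+ G) (hE : Continuous E)
    (hEo : IsOpenMap E) (hEb : Function.Bijective E) : IsVectorGroup G :=
  ⟨n, ⟨ContinuousAddEquiv.symm
    { AddEquiv.ofBijective E hEb with
      continuous_toFun := hE
      continuous_invFun :=
        ((Equiv.ofBijective E hEb).toHomeomorphOfContinuousOpen hE hEo).symm.continuous }⟩⟩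

theorem isFiniteDimTorus_of_bijective [T2Space G] {m : ℕ} (F : (Fin m → UnitAddCircle) →+ G)
    (hF : Continuous F) (hFb : Function.Bijective F) : IsFiniteDimTorus G :=
  ⟨m, ⟨ContinuousAddEquiv.symm
    { AddEquiv.ofBijective F hFb with
      continuous_toFun := hF
      continuous_invFun :=
        (Continuous.homeoOfEquivCompactToT2 (f := Equiv.ofBijective F hFb) hF).symm.continuous }⟩⟩

/-- The exponential map of a group without non-trivial compact subgroups. -/
theorem exists_injective_exponential [T2Space G] [LocallyCompactSpace G]
    (h : ∀ K : AddSubgroup G, IsCompact (K : Set G) → K = ⊥) :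
    ∃ (n : ℕ) (E : (Fin n → ℝ) →+ G), Continuous E ∧ IsOpenMap E ∧ Function.Injective E := by
  obtain ⟨n, E, hE, hEo, hEi⟩ := exists_exponential
    (hasLocallySeparatingCharacters_of_forall_compact univ_mem fun K hK _ => h K hK)
  exact ⟨n, E, hE, hEo, exponential_injective_of_forall_compact E hE hEo hEi h⟩

/-- A homomorphism from a connected group with open image is surjective. -/
theorem isVectorGroup_of_connected [T2Space G] [LocallyCompactSpace G] [PreconnectedSpace G]
    (h : ∀ K : AddSubgroup G, IsCompact (K : Set G) → K = ⊥) : IsVectorGroup G := by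
  obtain ⟨n, E, hE, hEo, hEi⟩ := exists_injective_exponential h
  have hopen : IsOpen (E.range : Set G) := hEo.isOpen_range
  have huniv : (E.range : Set G) = Set.univ :=
    IsClopen.eq_univ ⟨AddSubgroup.isClosed_of_isOpen _ hopen, hopen⟩ ⟨0, zero_mem _⟩
  exact isVectorGroup_of_bijective E hE hEo ⟨hEi, fun y => huniv.ge (Set.mem_univ y)⟩

/-- The quotient by the compact elements has no non-trivial compact subgroups. -/
theorem eq_bot_of_isCompact_of_isProperMap {H : Type*} [AddCommGroup H] [TopologicalSpace H]
    (f : G →+ H) (hf : IsProperMap f) (hs : Function.Surjective f)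
    (hker : ∀ x ∈ compactElements G, f x = 0) (K : AddSubgroup H) (hK : IsCompact (K : Set H)) :
    K = ⊥ := by
  refine (AddSubgroup.eq_bot_iff_forall K).2 fun y hy => ?_
  obtain ⟨x, rfl⟩ := hs y
  exact hker x ⟨K.comap f, hf.isCompact_preimage hK, hy⟩

end Groups

/-! ### The two decompositions -/

section Splitting

variable {S : Type*} [Ring S] {M : Type*} [AddCommGroup M] [Module S M] [TopologicalSpace M]
  [IsTopologicalAddGroup M] [T2Space M] [LocallyCompactSpace M] [ContinuousConstSMul S M]

/-- A connected module covered by a vector group is the sum of a vector module and a torus. -/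
theorem IsHereditaryOrder.exists_vector_torus (hS : IsHereditaryOrder S) {n : ℕ}
    (E : (Fin n → ℝ) →+ M) (hE : Continuous E) (hEo : IsOpenMap E)
    (hEi : ∃ ε > 0, ∀ v, ‖v‖ < ε → E v = 0 → v = 0) (hEs : Function.Surjective E) :
    ∃ T : Submodule S M, IsVectorGroup (M ⧸ T) ∧ IsFiniteDimTorus T ∧
      Nonempty (M ≃L[S] (M ⧸ T) × T) := by
  obtain ⟨m, F, hF, hFi, -, -, hFK⟩ := exists_maximal_torus E hE hEo hEi
  have hFc : IsCompact (F.range : Set M) := by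
    rw [AddMonoidHom.coe_range]
    exact isCompact_range hF
  -- The torus equals the set of compact elements, a description that makes its stability under `S`
  -- evident.
  let T := compactSubmodule S M
  have hTF : ∀ x, x ∈ T ↔ x ∈ F.range := by
    intro x
    refine ⟨fun ⟨K, hK, hx⟩ => ?_, fun hx => ⟨F.range, hFc, hx⟩⟩
    obtain ⟨v, rfl⟩ := hEs x
    exact hFK K hK v hx
  have hTc : IsCompact (T : Set M) := by
    convert hFc using 1
    ext x
    exact hTF x
  have hTcl : IsClosed (T : Set M) := hTc.isClosed
  have := locallyCompactSpace_quotient T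
  have hprop := isProperMap_mkQ T hTc
  have : PreconnectedSpace (M ⧸ T) :=
    (T.mkQ_surjective.comp hEs).denseRange.preconnectedSpace (T.continuous_mkQ.comp hE)
  have hW : IsVectorGroup (M ⧸ T) := isVectorGroup_of_connected
    (eq_bot_of_isCompact_of_isProperMap T.mkQ.toAddMonoidHom hprop T.mkQ_surjective
      fun x hx => (Submodule.Quotient.mk_eq_zero T).2 hx)
  obtain ⟨σ, hσ⟩ := hS.exists_section_of_isProperMap hW T.mkQL hprop T.mkQ_surjective
  refine ⟨T, hW, ?_, ⟨?_⟩⟩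
  · refine isFiniteDimTorus_of_bijective
      (F.codRestrict T.toAddSubgroup fun t => (hTF _).2 ⟨t, rfl⟩) (hF.subtype_mk _)
      ⟨fun s t hst => hFi (congrArg Subtype.val hst), fun x => ?_⟩
    obtain ⟨t, ht⟩ := (hTF x).1 x.2
    exact ⟨t, Subtype.ext ht⟩
  · have hker : T.mkQL.ker = T := T.ker_mkQ
    exact (ContinuousLinearEquiv.equivOfRightInverse T.mkQL σ hσ).trans
      ((ContinuousLinearEquiv.refl S _).prodCongr (ContinuousLinearEquiv.ofEq _ _ hker))

/-- The image of the exponential map is an open divisible submodule, so injectivity gives a linear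
retraction onto it. The retraction is continuous, being the identity on an open subgroup, and its
kernel is discrete, as it meets that subgroup only in 0. -/
theorem IsHereditaryOrder.splitsVectorTorusDiscrete (hS : IsHereditaryOrder S)
    (hM : NoSmallSubgroups M) : SplitsVectorTorusDiscrete S M := by
  obtain ⟨U, hU, hUM⟩ := hM
  obtain ⟨n, E, hE, hEo, hEi⟩ := exists_exponential
    (hasLocallySeparatingCharacters_of_forall_compact hU fun K _ hK => hUM K hK)
  let M₀ := exponentialSubmodule S E hE hEo
  have hopen : IsOpen (M₀ : Set M) := hEo.isOpen_range
  have hemb : IsOpenEmbedding (Subtype.val : M₀ → M) := hopen.isOpenEmbedding_subtypeVal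
  have : LocallyCompactSpace M₀ := hopen.locallyCompactSpace
  let E₀ : (Fin n → ℝ) →+ M₀ := E.codRestrict M₀.toAddSubgroup fun v => ⟨v, rfl⟩
  have hE₀ : Continuous E₀ := hE.subtype_mk _
  have hE₀o : IsOpenMap E₀ := fun V hV => by
    rw [hemb.isOpen_iff_image_isOpen, ← Set.image_comp]
    exact hEo V hV
  have hE₀i : ∃ ε > 0, ∀ v, ‖v‖ < ε → E₀ v = 0 → v = 0 := by
    obtain ⟨ε, hε, h⟩ := hEi
    exact ⟨ε, hε, fun v hv h0 => h v hv (congrArg Subtype.val h0)⟩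
  have hE₀s : Function.Surjective E₀ := by
    rintro ⟨_, v, rfl⟩
    exact ⟨v, rfl⟩
  obtain ⟨T, hW, hT, ⟨e⟩⟩ := hS.exists_vector_torus E₀ hE₀ hE₀o hE₀i hE₀s
  have hbaer : Module.Baer S M₀ := hS.baer_of_divisible M₀ fun x => by
    obtain ⟨v, rfl⟩ := hE₀s x
    refine ⟨E₀.comp (((LinearMap.toSpanSingleton ℝ _ v).toAddMonoidHom).comp
      (Rat.castHom ℝ).toAddMonoidHom), ?_⟩
    simp
  obtain ⟨ρ, hρ⟩ := hbaer.extension_property M₀.subtype M₀.injective_subtype LinearMap.id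
  have hρ' : ∀ x : M₀, ρ x = x := fun x => LinearMap.congr_fun hρ x
  have hρc : Continuous ρ := by
    refine continuous_of_continuousAt_zero ρ ?_
    have h1 : ContinuousAt (ρ ∘ (Subtype.val : M₀ → M)) 0 := by
      have : ρ ∘ (Subtype.val : M₀ → M) = id := funext hρ'
      rw [this]
      exact continuousAt_id
    exact hemb.continuousAt_iff.1 h1
  let ρL : M →L[S] M₀ := ⟨ρ, hρc⟩
  let e₁ := ContinuousLinearEquiv.equivOfRightInverse ρL M₀.subtypeL hρ'
  have hD : DiscreteTopology ρL.ker := by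
    rw [discreteTopology_iff_isOpen_singleton_zero]
    have h1 : ({0} : Set ρL.ker) = Subtype.val ⁻¹' (M₀ : Set M) := by
      ext x
      simp only [Set.mem_singleton_iff, Set.mem_preimage, SetLike.mem_coe]
      refine ⟨fun h => by rw [h]; exact zero_mem _, fun h => Subtype.ext ?_⟩
      have h2 := hρ' ⟨x, h⟩
      have h3 : ρ x = 0 := x.2
      rw [h3] at h2
      exact (congrArg Subtype.val h2).symm
    rw [h1]
    exact hopen.preimage continuous_subtype_val
  obtain ⟨V', T', D', ⟨eV⟩, ⟨eT⟩, ⟨eD⟩, hsum⟩ := exists_isTopDirectSum_of_equiv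
    (e₁.trans ((e.prodCongr (.refl S _)).trans (ContinuousLinearEquiv.prodAssoc S _ _ _))).symm
  obtain ⟨k, ⟨fV⟩⟩ := hW
  obtain ⟨l, ⟨fT⟩⟩ := hT
  exact ⟨V', T', D', ⟨k, ⟨(continuousAddEquivOfLinear eV).trans fV⟩⟩,
    ⟨l, ⟨(continuousAddEquivOfLinear eT).trans fT⟩⟩,
    eD.toHomeomorph.discreteTopology_iff.2 hD, hsum⟩

/-- Modulo the compact submodule `K` of compact elements, the exponential map embeds a vector module
`P₀` with lattice quotient. Projectivity of the lattice splits it off `M`, and the remaining kernel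
maps properly onto `P₀`, so it splits with compact kernel. -/
theorem IsHereditaryOrder.splitsVectorLatticeCompact (hS : IsHereditaryOrder S)
    (hM : CompactlyGeneratedGroup M) : SplitsVectorLatticeCompact S M := by
  let K := compactSubmodule S M
  have hK : IsCompact (K : Set M) := hM.isCompact_compactElements
  have hKcl : IsClosed (K : Set M) := hK.isClosed
  have := locallyCompactSpace_quotient K
  have hprop := isProperMap_mkQ K hK
  have hcpt : ∀ C : AddSubgroup (M ⧸ K), IsCompact (C : Set (M ⧸ K)) → C = ⊥ :=
    eq_bot_of_isCompact_of_isProperMap K.mkQ.toAddMonoidHom hprop K.mkQ_surjective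
      fun x hx => (Submodule.Quotient.mk_eq_zero K).2 hx
  obtain ⟨n, E, hE, hEo, hEi⟩ := exists_injective_exponential hcpt
  let P₀ := exponentialSubmodule S E hE hEo
  have hopen : IsOpen (P₀ : Set (M ⧸ K)) := hEo.isOpen_range
  have hemb : IsOpenEmbedding (Subtype.val : P₀ → M ⧸ K) := hopen.isOpenEmbedding_subtypeVal
  have hP₀ : IsVectorGroup P₀ := by
    refine isVectorGroup_of_bijective
      (E.codRestrict P₀.toAddSubgroup fun v => ⟨v, rfl⟩) (hE.subtype_mk _) (fun V hV => ?_)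
      ⟨fun v w h => hEi (congrArg Subtype.val h), ?_⟩
    · rw [hemb.isOpen_iff_image_isOpen, ← Set.image_comp]
      exact hEo V hV
    · rintro ⟨_, v, rfl⟩
      exact ⟨v, rfl⟩
  let f : M →L[S] (M ⧸ K) ⧸ P₀ := P₀.mkQL.comp K.mkQL
  have hfs : Function.Surjective f := P₀.mkQ_surjective.comp K.mkQ_surjective
  have hdisc : DiscreteTopology ((M ⧸ K) ⧸ P₀) :=
    QuotientAddGroup.discreteTopology (N := P₀.toAddSubgroup) hopen
  have hfin : Module.Finite ℤ ((M ⧸ K) ⧸ P₀) :=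
    (hM.of_surjective (f : M →+ _) f.continuous hfs).module_finite
  -- If `k • p ∈ P₀`, divide by `k` inside `P₀`: the difference has finite order, so it generates a
  -- finite, hence compact, subgroup of `M ⧸ K`, which must be trivial.
  have htf : IsAddTorsionFree ((M ⧸ K) ⧸ P₀) := by
    refine ⟨fun k hk x y hxy => ?_⟩
    obtain ⟨p, hp⟩ := P₀.mkQ_surjective (x - y)
    have h1 : k • p ∈ P₀ := by
      rw [← Submodule.Quotient.mk_eq_zero P₀, ← Submodule.mkQ_apply, map_nsmul, hp, smul_sub,
        sub_eq_zero]
      exact hxy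
    obtain ⟨v, hv⟩ := h1
    have h2 : k • E ((k : ℝ)⁻¹ • v) = k • p := by
      rw [← map_nsmul, ← Nat.cast_smul_eq_nsmul ℝ, smul_inv_smul₀ (Nat.cast_ne_zero.2 hk)]
      exact hv
    have h3 : IsOfFinAddOrder (p - E ((k : ℝ)⁻¹ • v)) :=
      isOfFinAddOrder_iff_nsmul_eq_zero.2 ⟨k, Nat.pos_of_ne_zero hk, by rw [smul_sub, h2, sub_self]⟩
    have h4 := hcpt _ h3.finite_zmultiples.isCompact
    rw [AddSubgroup.zmultiples_eq_bot, sub_eq_zero] at h4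
    have h5 : P₀.mkQ p = 0 := (Submodule.Quotient.mk_eq_zero P₀).2 ⟨_, h4.symm⟩
    rw [hp] at h5
    exact sub_eq_zero.1 h5
  have hfree : Module.Free ℤ ((M ⧸ K) ⧸ P₀) := inferInstance
  have := hS.projective_of_lattice ((M ⧸ K) ⧸ P₀)
  obtain ⟨s, hs⟩ := Module.projective_lifting_property f.toLinearMap LinearMap.id hfs
  let sL : (M ⧸ K) ⧸ P₀ →L[S] M := ⟨s, continuous_of_discreteTopology⟩
  let e₁ := ContinuousLinearEquiv.equivOfRightInverse f sL fun y => LinearMap.congr_fun hs y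
  have hker : IsClosed (f.ker : Set M) := isClosed_singleton.preimage f.continuous
  have hkemb : IsClosedEmbedding (Subtype.val : f.ker → M) := hker.isClosedEmbedding_subtypeVal
  have : LocallyCompactSpace f.ker := hker.locallyCompactSpace
  let π : f.ker →L[S] P₀ := (K.mkQL.comp f.ker.subtypeL).codRestrict P₀ fun x =>
    (Submodule.Quotient.mk_eq_zero P₀).1 x.2
  have hπ : IsProperMap π := isProperMap_of_comp_of_inj π.continuous continuous_subtype_val
    (hprop.comp hkemb.isProperMap) Subtype.val_injective
  have hπs : Function.Surjective π := by
    rintro ⟨y, hy⟩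
    obtain ⟨x, rfl⟩ := K.mkQ_surjective y
    exact ⟨⟨x, (Submodule.Quotient.mk_eq_zero P₀).2 hy⟩, rfl⟩
  obtain ⟨σ, hσ⟩ := hS.exists_section_of_isProperMap hP₀ π hπ hπs
  let e₂ := ContinuousLinearEquiv.equivOfRightInverse π σ hσ
  have hC : CompactSpace π.ker :=
    isCompact_iff_compactSpace.1 (hπ.isCompact_preimage (isCompact_singleton (x := 0)))
  obtain ⟨V', G', C', ⟨eV⟩, ⟨eG⟩, ⟨eC⟩, hsum⟩ := exists_isTopDirectSum_of_equiv
    -- Reorders lattice × (vector × compact) into vector × (lattice × compact).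
    (e₁.trans (((ContinuousLinearEquiv.refl S _).prodCongr e₂).trans
      ((ContinuousLinearEquiv.prodAssoc S _ _ _).symm.trans
        (((ContinuousLinearEquiv.prodComm S _ _).prodCongr (.refl S _)).trans
          (ContinuousLinearEquiv.prodAssoc S _ _ _))))).symm
  obtain ⟨k, ⟨fV⟩⟩ := hP₀
  have eGZ : G' ≃ₗ[ℤ] (M ⧸ K) ⧸ P₀ := eG.toLinearEquiv.toAddEquiv.toIntLinearEquiv
  exact ⟨V', G', C', ⟨k, ⟨(continuousAddEquivOfLinear eV).trans fV⟩⟩,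
    ⟨Module.Free.of_equiv eGZ.symm, Module.Finite.equiv eGZ.symm,
      eG.toHomeomorph.discreteTopology_iff.2 hdisc⟩,
    eC.toHomeomorph.symm.compactSpace, hsum⟩

end Splitting

end LCAModule

/-- Right `𝔄`-modules are modules over `𝔄ᵐᵒᵖ`. The first two claims are about locally compact
right `𝔄`-modules, the last two are their analogues for left `𝔄`-modules. -/
theorem mainTheorem12 {A : Type*} [Ring A] [Algebra ℚ A] [Module.Finite ℚ A]
    [IsSemisimpleRing A] (𝔄 : Subring A) (_h_order : LCAModule.IsZOrder 𝔄)
    (_h_hereditary : LCAModule.IsHereditaryRing 𝔄) :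
    (∀ (M : Type*) [AddCommGroup M] [Module 𝔄ᵐᵒᵖ M] [TopologicalSpace M]
        [IsTopologicalAddGroup M] [T2Space M] [LocallyCompactSpace M]
        [ContinuousConstSMul 𝔄ᵐᵒᵖ M],
      (LCAModule.NoSmallSubgroups M → LCAModule.SplitsVectorTorusDiscrete 𝔄ᵐᵒᵖ M) ∧
      (LCAModule.CompactlyGeneratedGroup M → LCAModule.SplitsVectorLatticeCompact 𝔄ᵐᵒᵖ M)) ∧
    (∀ (M : Type*) [AddCommGroup M] [Module 𝔄 M] [TopologicalSpace M]
        [IsTopologicalAddGroup M] [T2Space M] [LocallyCompactSpace M]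
        [ContinuousConstSMul 𝔄 M],
      (LCAModule.NoSmallSubgroups M → LCAModule.SplitsVectorTorusDiscrete 𝔄 M) ∧
      (LCAModule.CompactlyGeneratedGroup M → LCAModule.SplitsVectorLatticeCompact 𝔄 M)) := by
  have hl := _h_order.isHereditaryOrder _h_hereditary
  have hr := _h_order.isHereditaryOrder_mulOpposite _h_hereditary
  refine ⟨?_, ?_⟩
  · intro M _ _ _ _ _ _ _
    exact ⟨hr.splitsVectorTorusDiscrete, hr.splitsVectorLatticeCompact⟩
  · intro M _ _ _ _ _ _ _
    exact ⟨hl.splitsVectorTorusDiscrete, hl.splitsVectorLatticeCompact⟩
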